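/- For $a=(a_{00},a_{10},a_{01},a_{20},a_{11},a_{02},b_{00},b_{10},b_{01},b_{20},b_{11},b_{02})$ let $$p=a_{00}+a_{10}x+a_{01}y+a_{20}x^2+2a_{11}xy+a_{02}y^2,\qquad q=b_{00}+b_{10}x+b_{01}y+b_{20}x^2+2b_{11}xy+b_{02}y^2$$ be the right-hand sides of the quadratic system $\dot x=p(x,y)$, $\dot y=q(x,y)$; let $p_2,q_2$ be their parts of degree $2$, and put $P(X,Y,Z)=Z^2p(X/Z,Y/Z)$, $Q(X,Y,Z)=Z^2q(X/Z,Y/Z)$. On $\mathbb R[a,x,y]$, with the entries of $a$ as indeterminates, consider $\mathcal L=x\,\mathbf L_2-y\,\mathbf L_1$, where $$\mathbf L_1=2a_{00}\tfrac{\partial}{\partial a_{10}}+a_{10}\tfrac{\partial}{\partial a_{20}}+\tfrac12a_{01}\tfrac{\partial}{\partial a_{11}}+2b_{00}\tfrac{\partial}{\partial b_{10}}+b_{10}\tfrac{\partial}{\partial b_{20}}+\tfrac12b_{01}\tfrac{\partial}{\partial b_{11}},$$ $$\mathbf L_2=2a_{00}\tfrac{\partial}{\partial a_{01}}+a_{01}\tfrac{\partial}{\partial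 a_{02}}+\tfrac12a_{10}\tfrac{\partial}{\partial a_{11}}+2b_{00}\tfrac{\partial}{\partial b_{01}}+b_{01}\tfrac{\partial}{\partial b_{02}}+\tfrac12b_{10}\tfrac{\partial}{\partial b_{11}},$$ and define the comitants $\mu_0=\mathrm{Res}_x(p_2,q_2)/y^4$ and $\mu_i=\frac1{i!}\mathcal L^{i}(\mu_0)$ for $i\ge 1$. All resultants are $4\times4$ Sylvester determinants, i.e. they are formed with formal degrees $2,2$. (1) For every $a\in\mathbb R^{12}$ and $0\le i\le 4$, $\mu_i(a,x,y)$ is zero or a binary form of degree $i$ in $x,y$. If $\mu_{i0}(a)$ denotes its coefficient at $x^i$ and $\mu_{0i}(a)$ its coefficient at $y^i$ (so $\mu_{00}=\mu_0$), then $$\mathrm{Res}_X(P,Q)=\sum_{i=0}^4\mu_{i0}(a)\,Y^{4-i}Z^i,\qquad \mathrm{Res}_Y(P,Q)=\sum_{i=0}^4(-1)^i\mu_{0i}(a)\,X^{4-i}Z^i .$$ (2) Let $a\in\mathbb R^{12}$ be such that $\max(\deg p,\deg q)=2$ and $p,q$ are relatively prime in $\mathbb C[x,y]$, and let $1\le m\le4$.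 Then $P=Q=0$ has exactly $m$ solutions on the complex projective line $Z=0$ counted with multiplicity, that is, $\sum_w I_w(P,Q)=m$, where $w$ runs over the points of the line $Z=0$ in $\mathbb P^2(\mathbb C)$ and $I_w(P,Q)$ is the intersection number of the curves $P=0$ and $Q=0$ at $w$, if and only if $\mu_i(a,x,y)=0$ in $\mathbb R[x,y]$ for $i=0,\dots,m-1$ and $\mu_m(a,x,y)\neq0$ in $\mathbb R[x,y]$. -/

import Mathlib

noncomputable section

namespace QuadSys

open MvPolynomial

/-- The names of the twelve coefficients of a planar quadratic system
`x' = a00 + a10 x + a01 y + a20 x² + 2 a11 x y + a02 y²`,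
`y' = b00 + b10 x + b01 y + b20 x² + 2 b11 x y + b02 y²`.
A system with coefficients in `R` is a function `Coef → R`. -/
inductive Coef : Type
  | a00 | a10 | a01 | a20 | a11 | a02
  | b00 | b10 | b01 | b20 | b11 | b02

open Coef

section Forms

variable {R : Type*} [CommRing R]

/-- The polynomial `p(x, y)`; here `x = X 0` and `y = X 1`. -/
def p (a : Coef → R) : MvPolynomial (Fin 2) R :=
  C (a a00) + C (a a10) * X 0 + C (a a01) * X 1
    + C (a a20) * X 0 ^ 2 + C (2 * a a11) * (X 0 * X 1) + C (a a02) * X 1 ^ 2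

/-- The polynomial `q(x, y)`. -/
def q (a : Coef → R) : MvPolynomial (Fin 2) R :=
  C (a b00) + C (a b10) * X 0 + C (a b01) * X 1
    + C (a b20) * X 0 ^ 2 + C (2 * a b11) * (X 0 * X 1) + C (a b02) * X 1 ^ 2

/-- The form `P(X, Y, Z) = Z² p(X/Z, Y/Z)`; here `X = X 0`, `Y = X 1`, `Z = X 2`. -/
def P (a : Coef → R) : MvPolynomial (Fin 3) R :=
  C (a a00) * X 2 ^ 2 + C (a a10) * (X 0 * X 2) + C (a a01) * (X 1 * X 2)
    + C (a a20) * X 0 ^ 2 + C (2 * a a11) * (X 0 * X 1) + C (a a02) * X 1 ^ 2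

/-- The form `Q(X, Y, Z) = Z² q(X/Z, Y/Z)`. -/
def Q (a : Coef → R) : MvPolynomial (Fin 3) R :=
  C (a b00) * X 2 ^ 2 + C (a b10) * (X 0 * X 2) + C (a b01) * (X 1 * X 2)
    + C (a b20) * X 0 ^ 2 + C (2 * a b11) * (X 0 * X 1) + C (a b02) * X 1 ^ 2

/-- A form in `X, Y, Z` seen as a polynomial in its `i`-th variable whose coefficients are
polynomials in the other two variables. -/
def asPolyIn (i : Fin 3) (F : MvPolynomial (Fin 3) R) : Polynomial (MvPolynomial (Fin 3) R) :=
  aeval (Function.update (fun j => Polynomial.C (X j)) i Polynomial.X) F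

/-- The resultant with respect to the `i`-th variable of two ternary quadratic forms
(the `4 × 4` Sylvester determinant, both forms taken with formal degree `2`). -/
def resQuadratic (i : Fin 3) (F G : MvPolynomial (Fin 3) R) : MvPolynomial (Fin 3) R :=
  Polynomial.resultant (asPolyIn i F) (asPolyIn i G) 2 2

end Forms

/-! ### The polynomials `μ_i` -/

/-- The ring `ℝ[a, x, y]` in the twelve coefficients and the two variables `x, y`. -/
abbrev RingAXY : Type := MvPolynomial (Coef ⊕ Fin 2) ℝ

/-- A coefficient of the generic system, as an element of `ℝ[a, x, y]`. -/
def cf (c : Coef) : RingAXY := X (Sum.inl c)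

/-- The partial derivative of `ℝ[a, x, y]` with respect to a coefficient. -/
def dcf (c : Coef) : Derivation ℝ RingAXY RingAXY := pderiv (Sum.inl c)

/-- The differential operator `L₁`. -/
def L1 : Derivation ℝ RingAXY RingAXY :=
  (2 * cf a00) • dcf a10 + cf a10 • dcf a20 + (C (1 / 2) * cf a01) • dcf a11
    + (2 * cf b00) • dcf b10 + cf b10 • dcf b20 + (C (1 / 2) * cf b01) • dcf b11

/-- The differential operator `L₂`. -/
def L2 : Derivation ℝ RingAXY RingAXY :=
  (2 * cf a00) • dcf a01 + cf a01 • dcf a02 + (C (1 / 2) * cf a10) • dcf a11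
    + (2 * cf b00) • dcf b01 + cf b01 • dcf b02 + (C (1 / 2) * cf b10) • dcf b11

/-- The differential operator `𝓛 = x L₂ - y L₁`. -/
def opL : Derivation ℝ RingAXY RingAXY :=
  (X (Sum.inr 0) : RingAXY) • L2 - (X (Sum.inr 1) : RingAXY) • L1

/-- `μ₀ = Res_x(p₂, q₂) / y⁴`, the resultant in `x` of the quadratic parts at `y = 1`. -/
def mu0 : RingAXY :=
  Polynomial.resultant
    (Polynomial.C (cf a20) * Polynomial.X ^ 2 + Polynomial.C (2 * cf a11) * Polynomial.X
      + Polynomial.C (cf a02))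
    (Polynomial.C (cf b20) * Polynomial.X ^ 2 + Polynomial.C (2 * cf b11) * Polynomial.X
      + Polynomial.C (cf b02)) 2 2

/-- `μ_i = (1 / i!) 𝓛^i (μ₀)`. -/
def mu (i : ℕ) : RingAXY := C (1 / (i.factorial : ℝ)) * (opL^[i] mu0)

/-- The polynomial `μ_i(a, x, y) ∈ ℝ[x, y]` of a given real system `a`. -/
def muAt (a : Coef → ℝ) (i : ℕ) : MvPolynomial (Fin 2) ℝ :=
  aeval (Sum.elim (fun c => C (a c)) X : Coef ⊕ Fin 2 → MvPolynomial (Fin 2) ℝ) (mu i)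

/-! ### Intersection multiplicities -/

/-- The ideal of all polynomials that vanish at the point `c`. -/
def idealAt (c : Fin 2 → ℂ) : Ideal (MvPolynomial (Fin 2) ℂ) := RingHom.ker (eval c)

instance idealAt_isPrime (c : Fin 2 → ℂ) : (idealAt c).IsPrime := RingHom.ker_isPrime _

/-- The local ring of the complex affine plane at the point `c`. -/
abbrev LocalRingAt (c : Fin 2 → ℂ) : Type := Localization.AtPrime (idealAt c)

/-- The intersection number at the point `c` of the affine plane curves `f = 0` and `g = 0`:
the dimension over `ℂ` (possibly infinite) of the local ring at `c` modulo `(f, g)`. -/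
def affineIntersection (c : Fin 2 → ℂ) (f g : MvPolynomial (Fin 2) ℂ) : ℕ∞ :=
  Cardinal.toENat (Module.rank ℂ
    (LocalRingAt c ⧸ (Ideal.span {algebraMap _ (LocalRingAt c) f, algebraMap _ (LocalRingAt c) g} :
      Ideal (LocalRingAt c))))

/-- The dehomogenization of `F`, obtained by setting the `i`-th variable equal to `1`. -/
def dehomogenize (i : Fin 3) (F : MvPolynomial (Fin 3) ℂ) : MvPolynomial (Fin 2) ℂ :=
  aeval (i.insertNth 1 (fun j => X j) : Fin 3 → MvPolynomial (Fin 2) ℂ) F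

open Classical in
/-- The index of an affine chart of the complex projective plane that contains `w`:
that of the first nonzero homogeneous coordinate. -/
def chartIndex (w : Projectivization ℂ (Fin 3 → ℂ)) : Fin 3 :=
  if w.rep 0 ≠ 0 then 0 else if w.rep 1 ≠ 0 then 1 else 2

/-- The affine coordinates of `w` in that chart. -/
def chartPoint (w : Projectivization ℂ (Fin 3 → ℂ)) : Fin 2 → ℂ :=
  fun j => w.rep ((chartIndex w).succAbove j) / w.rep (chartIndex w)

/-- The intersection number `I_w(F, G)` at the point `w` of the complex projective plane of the
curves `F = 0` and `G = 0`, computed in an affine chart around `w`. -/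
def intersectionNumber (w : Projectivization ℂ (Fin 3 → ℂ)) (F G : MvPolynomial (Fin 3) ℂ) : ℕ∞ :=
  affineIntersection (chartPoint w) (dehomogenize (chartIndex w) F) (dehomogenize (chartIndex w) G)

/-- The set of points of the complex line `Z = 0`. -/
def lineAtInfinity : Set (Projectivization ℂ (Fin 3 → ℂ)) := {w | w.rep 2 = 0}

/-- The system with complex coefficients underlying a real system. -/
def toComplex (a : Coef → ℝ) : Coef → ℂ := fun c => (a c : ℂ)

/-- The number of solutions of `P = Q = 0` on the complex line `Z = 0`, counted with multiplicity:
the sum of `I_w(P, Q)` over all points `w` of that line, which is the supremum in `ℕ∞` of all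
finite partial sums. -/
def numSolutionsAtInfinity (a : Coef → ℝ) : ℕ∞ :=
  ⨆ s : Finset lineAtInfinity,
    ∑ w ∈ s, intersectionNumber w (P (toComplex a)) (Q (toComplex a))

end QuadSys

end

/-! The operator `𝓛` generates the substitution `Z ↦ Z + T (x Y - y X)` in `P` and `Q`: carrying it
out on the coefficients is `exp (T 𝓛)`, the algebra map `flow`. Hence `∑ μ_i T^i` is `μ₀` of the
transformed system, that is, the resultant of the binary quadratic forms obtained by restricting `P`
and `Q` to the line `Z = T (x Y - y X)`. Since `T` enters only through `T x` and `T y`, `μ_i` is a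
form of degree `i` and the sum stops at `i = 4`. Taking `(x, y) = (1, 0)` and `(0, 1)` gives the two
resultants of (1), the second with `Z = -T X`, whence the signs.

For (2), take `(x, y) = (1, v)` where `(1 : v : 0)` is not a common zero of `P` and `Q`. In the
chart `Y - v X = 1`, with coordinates `s = X` and `z = Z`, the curves are quadratics in `s` over
`ℂ[z]`, one of them with a nonzero constant as leading coefficient, and their resultant in `s` is `∑
μ_i(1, v) z^i`. The intersection numbers on `z = 0` add up to the order of this resultant at `z = 0`
(`sum_affineIntersection`), and no point at infinity is missed, because the one outside the chart
contributes `0` (`iSup_intersectionNumber`). Coprimality of `p` and `q` makes the resultant nonzero,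
so the count is the first `N` with `μ_N(1, v) ≠ 0`.

The count does not depend on `v`, and all but finitely many real `v` are admissible. So for `i < N`
the form `μ_i` vanishes in infinitely many directions, hence identically, while `μ_N ≠ 0`
(`exists_numSolutionsAtInfinity_muAt`). -/

noncomputable section

namespace QuadSys

open MvPolynomial Coef

/-! ### The comitants `μ_i` as coefficients of one resultant -/

/-- The resultant of `f₂ s² + f₁ s + f₀` and `g₂ s² + g₁ s + g₀`. -/
def quadRes {R : Type*} [CommRing R] (f₂ f₁ f₀ g₂ g₁ g₀ : R) : R :=
  (f₂ * g₀ - f₀ * g₂) ^ 2 - (f₂ * g₁ - f₁ * g₂) * (f₁ * g₀ - f₀ * g₁)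

theorem resultant_quadratic {R : Type*} [CommRing R] (f₂ f₁ f₀ g₂ g₁ g₀ : R) :
    Polynomial.resultant
      (Polynomial.C f₂ * Polynomial.X ^ 2 + Polynomial.C f₁ * Polynomial.X + Polynomial.C f₀)
      (Polynomial.C g₂ * Polynomial.X ^ 2 + Polynomial.C g₁ * Polynomial.X + Polynomial.C g₀) 2 2 =
    quadRes f₂ f₁ f₀ g₂ g₁ g₀ := by
  have hm : Polynomial.sylvester
      (Polynomial.C f₂ * Polynomial.X ^ 2 + Polynomial.C f₁ * Polynomial.X + Polynomial.C f₀)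
      (Polynomial.C g₂ * Polynomial.X ^ 2 + Polynomial.C g₁ * Polynomial.X + Polynomial.C g₀) 2 2 =
      !![g₀, 0, f₀, 0; g₁, g₀, f₁, f₀; g₂, g₁, f₂, f₁; 0, g₂, 0, f₂] := by
    ext i j
    fin_cases i <;> fin_cases j <;>
      simp [Polynomial.sylvester, Fin.addCases, Polynomial.coeff_X, Polynomial.coeff_C]
  rw [Polynomial.resultant, hm, Matrix.det_succ_row_zero]
  simp [Fin.sum_univ_succ, Matrix.det_fin_three, Matrix.submatrix, Fin.succAbove, quadRes]
  ring

/-- The coefficient of `x ^ (i - j) * y ^ j` in `μ_i`. -/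
def muCoeff {R : Type*} [CommRing R] (a : Coef → R) : ℕ → ℕ → R
  | 0, 0 => a a20 ^ 2 * a b02 ^ 2 - 4 * a a20 * a a11 * a b11 * a b02 - 2 * a a20 * a a02 * a
      b20 * a b02 + 4 * a a20 * a a02 * a b11 ^ 2 + 4 * a a11 ^ 2 * a b20 * a b02 - 4 * a a11 *
      a a02 * a b20 * a b11 + a a02 ^ 2 * a b20 ^ 2
  | 1, 0 => -2 * a a10 * a a20 * a b11 * a b02 + 4 * a a10 * a a11 * a b20 * a b02 - 2 * a a10 *
      a a02 * a b20 * a b11 - 2 * a a01 * a a20 * a b20 * a b02 + 4 * a a01 * a a20 * a b11 ^ 2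
      - 4 * a a01 * a a11 * a b20 * a b11 + 2 * a a01 * a a02 * a b20 ^ 2 + 2 * a a20 ^ 2 * a
      b01 * a b02 - 2 * a a20 * a a11 * a b10 * a b02 - 4 * a a20 * a a11 * a b01 * a b11 + 4 *
      a a20 * a a02 * a b10 * a b11 - 2 * a a20 * a a02 * a b01 * a b20 + 4 * a a11 ^ 2 * a b01
      * a b20 - 2 * a a11 * a a02 * a b10 * a b20
  | 1, 1 => -2 * a a10 * a a20 * a b02 ^ 2 + 4 * a a10 * a a11 * a b11 * a b02 + 2 * a a10 * a
      a02 * a b20 * a b02 - 4 * a a10 * a a02 * a b11 ^ 2 + 2 * a a01 * a a20 * a b11 * a b02 -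
      4 * a a01 * a a11 * a b20 * a b02 + 2 * a a01 * a a02 * a b20 * a b11 + 2 * a a20 * a a11
      * a b01 * a b02 + 2 * a a20 * a a02 * a b10 * a b02 - 4 * a a20 * a a02 * a b01 * a b11 -
      4 * a a11 ^ 2 * a b10 * a b02 + 4 * a a11 * a a02 * a b10 * a b11 + 2 * a a11 * a a02 * a
      b01 * a b20 - 2 * a a02 ^ 2 * a b10 * a b20
  | 2, 0 => -2 * a a00 * a a20 * a b20 * a b02 + 4 * a a00 * a a20 * a b11 ^ 2 - 4 * a a00 * a
      a11 * a b20 * a b11 + 2 * a a00 * a a02 * a b20 ^ 2 + a a10 ^ 2 * a b20 * a b02 - 2 * a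
      a10 * a a01 * a b20 * a b11 - a a10 * a a20 * a b10 * a b02 - 2 * a a10 * a a20 * a b01 *
      a b11 + 4 * a a10 * a a11 * a b01 * a b20 - a a10 * a a02 * a b10 * a b20 + a a01 ^ 2 * a
      b20 ^ 2 + 4 * a a01 * a a20 * a b10 * a b11 - 2 * a a01 * a a20 * a b01 * a b20 - 2 * a
      a01 * a a11 * a b10 * a b20 + 2 * a a20 ^ 2 * a b00 * a b02 + a a20 ^ 2 * a b01 ^ 2 - 4 *
      a a20 * a a11 * a b00 * a b11 - 2 * a a20 * a a11 * a b10 * a b01 - 2 * a a20 * a a02 * a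
      b00 * a b20 + a a20 * a a02 * a b10 ^ 2 + 4 * a a11 ^ 2 * a b00 * a b20
  | 2, 1 => 4 * a a00 * a a20 * a b11 * a b02 - 8 * a a00 * a a11 * a b20 * a b02 + 4 * a a00 *
      a a02 * a b20 * a b11 + 2 * a a10 ^ 2 * a b11 * a b02 - 4 * a a10 * a a01 * a b11 ^ 2 - 3
      * a a10 * a a20 * a b01 * a b02 - 2 * a a10 * a a11 * a b10 * a b02 + 4 * a a10 * a a11 *
      a b01 * a b11 - 2 * a a10 * a a02 * a b10 * a b11 + 3 * a a10 * a a02 * a b01 * a b20 + 2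
      * a a01 ^ 2 * a b20 * a b11 + 3 * a a01 * a a20 * a b10 * a b02 - 2 * a a01 * a a20 * a
      b01 * a b11 + 4 * a a01 * a a11 * a b10 * a b11 - 2 * a a01 * a a11 * a b01 * a b20 - 3 *
      a a01 * a a02 * a b10 * a b20 + 4 * a a20 * a a11 * a b00 * a b02 + 2 * a a20 * a a11 * a
      b01 ^ 2 - 8 * a a20 * a a02 * a b00 * a b11 - 4 * a a11 ^ 2 * a b10 * a b01 + 4 * a a11 *
      a a02 * a b00 * a b20 + 2 * a a11 * a a02 * a b10 ^ 2
  | 2, 2 => 2 * a a00 * a a20 * a b02 ^ 2 - 4 * a a00 * a a11 * a b11 * a b02 - 2 * a a00 * a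
      a02 * a b20 * a b02 + 4 * a a00 * a a02 * a b11 ^ 2 + a a10 ^ 2 * a b02 ^ 2 - 2 * a a10 *
      a a01 * a b11 * a b02 - 2 * a a10 * a a11 * a b01 * a b02 - 2 * a a10 * a a02 * a b10 * a
      b02 + 4 * a a10 * a a02 * a b01 * a b11 + a a01 ^ 2 * a b20 * a b02 - a a01 * a a20 * a
      b01 * a b02 + 4 * a a01 * a a11 * a b10 * a b02 - 2 * a a01 * a a02 * a b10 * a b11 - a
      a01 * a a02 * a b01 * a b20 - 2 * a a20 * a a02 * a b00 * a b02 + a a20 * a a02 * a b01 ^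
      2 + 4 * a a11 ^ 2 * a b00 * a b02 - 4 * a a11 * a a02 * a b00 * a b11 - 2 * a a11 * a a02
      * a b10 * a b01 + 2 * a a02 ^ 2 * a b00 * a b20 + a a02 ^ 2 * a b10 ^ 2
  | 3, 0 => -2 * a a00 * a a10 * a b20 * a b11 + 2 * a a00 * a a01 * a b20 ^ 2 + 4 * a a00 * a
      a20 * a b10 * a b11 - 2 * a a00 * a a20 * a b01 * a b20 - 2 * a a00 * a a11 * a b10 * a
      b20 + a a10 ^ 2 * a b01 * a b20 - a a10 * a a01 * a b10 * a b20 - 2 * a a10 * a a20 * a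
      b00 * a b11 - a a10 * a a20 * a b10 * a b01 + 4 * a a10 * a a11 * a b00 * a b20 - 2 * a
      a01 * a a20 * a b00 * a b20 + a a01 * a a20 * a b10 ^ 2 + 2 * a a20 ^ 2 * a b00 * a b01 -
      2 * a a20 * a a11 * a b00 * a b10
  | 3, 1 => -2 * a a00 * a a10 * a b20 * a b02 - 4 * a a00 * a a10 * a b11 ^ 2 + 6 * a a00 * a
      a01 * a b20 * a b11 + 4 * a a00 * a a20 * a b10 * a b02 + 4 * a a00 * a a11 * a b10 * a
      b11 - 6 * a a00 * a a11 * a b01 * a b20 - 2 * a a00 * a a02 * a b10 * a b20 + 2 * a a10 ^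
      2 * a b01 * a b11 - 2 * a a10 * a a01 * a b10 * a b11 + a a10 * a a01 * a b01 * a b20 - 2
      * a a10 * a a20 * a b00 * a b02 - a a10 * a a20 * a b01 ^ 2 + 4 * a a10 * a a11 * a b00 *
      a b11 - 2 * a a10 * a a11 * a b10 * a b01 + 4 * a a10 * a a02 * a b00 * a b20 - a a01 ^ 2
      * a b10 * a b20 - 6 * a a01 * a a20 * a b00 * a b11 + a a01 * a a20 * a b10 * a b01 + 2 *
      a a01 * a a11 * a b10 ^ 2 + 6 * a a20 * a a11 * a b00 * a b01 - 2 * a a20 * a a02 * a b00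
      * a b10 - 4 * a a11 ^ 2 * a b00 * a b10
  | 3, 2 => -6 * a a00 * a a10 * a b11 * a b02 + 2 * a a00 * a a01 * a b20 * a b02 + 4 * a a00 *
      a a01 * a b11 ^ 2 + 2 * a a00 * a a20 * a b01 * a b02 + 6 * a a00 * a a11 * a b10 * a b02
      - 4 * a a00 * a a11 * a b01 * a b11 - 4 * a a00 * a a02 * a b01 * a b20 + a a10 ^ 2 * a
      b01 * a b02 - a a10 * a a01 * a b10 * a b02 + 2 * a a10 * a a01 * a b01 * a b11 - 2 * a
      a10 * a a11 * a b01 ^ 2 + 6 * a a10 * a a02 * a b00 * a b11 - a a10 * a a02 * a b10 * a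
      b01 - 2 * a a01 ^ 2 * a b10 * a b11 - 4 * a a01 * a a20 * a b00 * a b02 - 4 * a a01 * a
      a11 * a b00 * a b11 + 2 * a a01 * a a11 * a b10 * a b01 + 2 * a a01 * a a02 * a b00 * a
      b20 + a a01 * a a02 * a b10 ^ 2 + 2 * a a20 * a a02 * a b00 * a b01 + 4 * a a11 ^ 2 * a
      b00 * a b01 - 6 * a a11 * a a02 * a b00 * a b10
  | 3, 3 => -2 * a a00 * a a10 * a b02 ^ 2 + 2 * a a00 * a a01 * a b11 * a b02 + 2 * a a00 * a
      a11 * a b01 * a b02 + 2 * a a00 * a a02 * a b10 * a b02 - 4 * a a00 * a a02 * a b01 * a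
      b11 + a a10 * a a01 * a b01 * a b02 + 2 * a a10 * a a02 * a b00 * a b02 - a a10 * a a02 *
      a b01 ^ 2 - a a01 ^ 2 * a b10 * a b02 - 4 * a a01 * a a11 * a b00 * a b02 + 2 * a a01 * a
      a02 * a b00 * a b11 + a a01 * a a02 * a b10 * a b01 + 2 * a a11 * a a02 * a b00 * a b01 -
      2 * a a02 ^ 2 * a b00 * a b10
  | 4, 0 => a a00 ^ 2 * a b20 ^ 2 - a a00 * a a10 * a b10 * a b20 - 2 * a a00 * a a20 * a b00 *
      a b20 + a a00 * a a20 * a b10 ^ 2 + a a10 ^ 2 * a b00 * a b20 - a a10 * a a20 * a b00 * a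
      b10 + a a20 ^ 2 * a b00 ^ 2
  | 4, 1 => 4 * a a00 ^ 2 * a b20 * a b11 - 2 * a a00 * a a10 * a b10 * a b11 - a a00 * a a10 *
      a b01 * a b20 - a a00 * a a01 * a b10 * a b20 - 4 * a a00 * a a20 * a b00 * a b11 + 2 * a
      a00 * a a20 * a b10 * a b01 - 4 * a a00 * a a11 * a b00 * a b20 + 2 * a a00 * a a11 * a
      b10 ^ 2 + 2 * a a10 ^ 2 * a b00 * a b11 + 2 * a a10 * a a01 * a b00 * a b20 - a a10 * a
      a20 * a b00 * a b01 - 2 * a a10 * a a11 * a b00 * a b10 - a a01 * a a20 * a b00 * a b10 +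
      4 * a a20 * a a11 * a b00 ^ 2
  | 4, 2 => 2 * a a00 ^ 2 * a b20 * a b02 + 4 * a a00 ^ 2 * a b11 ^ 2 - a a00 * a a10 * a b10 *
      a b02 - 2 * a a00 * a a10 * a b01 * a b11 - 2 * a a00 * a a01 * a b10 * a b11 - a a00 * a
      a01 * a b01 * a b20 - 2 * a a00 * a a20 * a b00 * a b02 + a a00 * a a20 * a b01 ^ 2 - 8 *
      a a00 * a a11 * a b00 * a b11 + 4 * a a00 * a a11 * a b10 * a b01 - 2 * a a00 * a a02 * a
      b00 * a b20 + a a00 * a a02 * a b10 ^ 2 + a a10 ^ 2 * a b00 * a b02 + 4 * a a10 * a a01 *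
      a b00 * a b11 - 2 * a a10 * a a11 * a b00 * a b01 - a a10 * a a02 * a b00 * a b10 + a a01
      ^ 2 * a b00 * a b20 - a a01 * a a20 * a b00 * a b01 - 2 * a a01 * a a11 * a b00 * a b10 +
      2 * a a20 * a a02 * a b00 ^ 2 + 4 * a a11 ^ 2 * a b00 ^ 2
  | 4, 3 => 4 * a a00 ^ 2 * a b11 * a b02 - a a00 * a a10 * a b01 * a b02 - a a00 * a a01 * a
      b10 * a b02 - 2 * a a00 * a a01 * a b01 * a b11 - 4 * a a00 * a a11 * a b00 * a b02 + 2 *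
      a a00 * a a11 * a b01 ^ 2 - 4 * a a00 * a a02 * a b00 * a b11 + 2 * a a00 * a a02 * a b10
      * a b01 + 2 * a a10 * a a01 * a b00 * a b02 - a a10 * a a02 * a b00 * a b01 + 2 * a a01 ^
      2 * a b00 * a b11 - 2 * a a01 * a a11 * a b00 * a b01 - a a01 * a a02 * a b00 * a b10 + 4
      * a a11 * a a02 * a b00 ^ 2
  | 4, 4 => a a00 ^ 2 * a b02 ^ 2 - a a00 * a a01 * a b01 * a b02 - 2 * a a00 * a a02 * a b00 *
      a b02 + a a00 * a a02 * a b01 ^ 2 + a a01 ^ 2 * a b00 * a b02 - a a01 * a a02 * a b00 * a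
      b01 + a a02 ^ 2 * a b00 ^ 2
  | _, _ => 0

/-- The flow of the derivation `𝓛`: the substitution `exp(T 𝓛)`. -/
def flow : RingAXY →ₐ[ℝ] Polynomial RingAXY :=
  let x : Polynomial RingAXY := Polynomial.C (X (Sum.inr 0))
  let y : Polynomial RingAXY := Polynomial.C (X (Sum.inr 1))
  let c : Coef → Polynomial RingAXY := fun k => Polynomial.C (cf k)
  let T : Polynomial RingAXY := Polynomial.X
  let half : Polynomial RingAXY := Polynomial.C (C (1 / 2))
  aeval (Sum.elim (fun k => match k with
    | a00 => c a00
    | a10 => c a10 - 2 * y * c a00 * T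
    | a01 => c a01 + 2 * x * c a00 * T
    | a20 => c a20 - y * c a10 * T + y ^ 2 * c a00 * T ^ 2
    | a11 => c a11 + half * (x * c a10 - y * c a01) * T - x * y * c a00 * T ^ 2
    | a02 => c a02 + x * c a01 * T + x ^ 2 * c a00 * T ^ 2
    | b00 => c b00
    | b10 => c b10 - 2 * y * c b00 * T
    | b01 => c b01 + 2 * x * c b00 * T
    | b20 => c b20 - y * c b10 * T + y ^ 2 * c b00 * T ^ 2
    | b11 => c b11 + half * (x * c b10 - y * c b01) * T - x * y * c b00 * T ^ 2
    | b02 => c b02 + x * c b01 * T + x ^ 2 * c b00 * T ^ 2) ![x, y])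

theorem constantCoeff_flow (f : RingAXY) : (flow f).coeff 0 = f := by
  have h : (Polynomial.constantCoeff.comp flow.toRingHom : RingAXY →+* RingAXY) =
      RingHom.id RingAXY := by
    apply MvPolynomial.ringHom_ext
    · intro r
      simp [flow, Polynomial.algebraMap_apply, MvPolynomial.algebraMap_eq]
    · intro i
      rcases i with k | j
      · cases k <;> simp [flow, cf]
      · fin_cases j <;> simp [flow]
  exact congrArg (fun φ : RingAXY →+* RingAXY => φ f) h

theorem dcf_self (k : Coef) : dcf k (cf k) = 1 := pderiv_X_self _

theorem dcf_of_ne {k l : Coef} (h : l ≠ k) : dcf k (cf l) = 0 :=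
  pderiv_X_of_ne fun e => h (Sum.inl.inj e)

theorem opL_cf (k : Coef) :
    opL (cf k) = match k with
      | a00 => 0
      | a10 => -(2 * X (Sum.inr 1) * cf a00)
      | a01 => 2 * X (Sum.inr 0) * cf a00
      | a20 => -(X (Sum.inr 1) * cf a10)
      | a11 => C (1 / 2) * (X (Sum.inr 0) * cf a10 - X (Sum.inr 1) * cf a01)
      | a02 => X (Sum.inr 0) * cf a01
      | b00 => 0
      | b10 => -(2 * X (Sum.inr 1) * cf b00)
      | b01 => 2 * X (Sum.inr 0) * cf b00
      | b20 => -(X (Sum.inr 1) * cf b10)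
      | b11 => C (1 / 2) * (X (Sum.inr 0) * cf b10 - X (Sum.inr 1) * cf b01)
      | b02 => X (Sum.inr 0) * cf b01 := by
  cases k <;>
    simp only [opL, L1, L2, Derivation.sub_apply, Derivation.add_apply, Derivation.smul_apply,
      smul_eq_mul, dcf_self, dcf_of_ne, ne_eq, reduceCtorEq, not_false_eq_true, mul_zero, mul_one,
      add_zero, zero_add, sub_zero, zero_sub] <;>
    ring

theorem opL_xy (j : Fin 2) : opL (X (Sum.inr j)) = 0 := by
  have h : ∀ k, dcf k (X (Sum.inr j)) = 0 := fun k => pderiv_X_of_ne Sum.inr_ne_inl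
  simp [opL, L1, L2, h]

theorem flow_half : flow (C (1 / 2)) = Polynomial.C (C (1 / 2)) := by
  have h1 : (C (1 / 2) : RingAXY) = algebraMap ℝ RingAXY (1 / 2) := rfl
  rw [h1, AlgHom.commutes, Polynomial.algebraMap_apply]

theorem two_mul_half :
    2 * (Polynomial.C (C (1 / 2) : RingAXY) : Polynomial RingAXY) = 1 := by
  rw [← map_ofNat Polynomial.C 2, ← map_mul, ← map_ofNat C 2, ← map_mul]
  norm_num

theorem flow_xy (j : Fin 2) : flow (X (Sum.inr j)) = Polynomial.C (X (Sum.inr j)) := by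
  fin_cases j <;> simp [flow]

theorem derivative_flow_cf (k : Coef) :
    Polynomial.derivative (flow (cf k)) = flow (opL (cf k)) := by
  have e : ∀ l, flow (cf l) = aeval (R := ℝ) _ (X (Sum.inl l)) := fun l => rfl
  have h2 := two_mul_half
  rw [opL_cf]
  cases k <;>
    simp only [map_zero, map_mul, map_sub, map_neg, map_ofNat, flow_half, flow_xy] <;>
    simp only [e, aeval_X, Sum.elim_inl, Polynomial.derivative_add, Polynomial.derivative_sub,
      Polynomial.derivative_mul, Polynomial.derivative_C,
      Polynomial.derivative_X, Polynomial.derivative_ofNat, Polynomial.derivative_pow] <;>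
    simp only [Nat.cast_ofNat, Nat.reduceSub, pow_one, map_ofNat, zero_mul, mul_zero, zero_add,
      mul_one, add_zero, zero_sub] <;>
    first
    | ring1
    -- For `a11` and `b11` the two sides differ by a multiple of `2 * ½ - 1`: `ring1` treats the
    -- constant `½` as an atom.
    | linear_combination (2 * Polynomial.C (X (Sum.inr 0)) * Polynomial.C (X (Sum.inr 1)) *
        Polynomial.C (cf a00) * Polynomial.X) * h2
    | linear_combination (2 * Polynomial.C (X (Sum.inr 0)) * Polynomial.C (X (Sum.inr 1)) *
        Polynomial.C (cf b00) * Polynomial.X) * h2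

/-- Both sides are derivations along the homomorphism `flow`, so it is enough to compare them on
constants and variables. With `constantCoeff_flow` this identifies `flow` with `exp (T 𝓛)`. -/
theorem derivative_flow (f : RingAXY) :
    Polynomial.derivative (flow f) = flow (opL f) := by
  induction f using MvPolynomial.induction_on with
  | C r =>
    have h1 : (C r : RingAXY) = algebraMap ℝ RingAXY r := rfl
    rw [h1, AlgHom.commutes, Derivation.map_algebraMap, map_zero, Polynomial.algebraMap_apply,
      Polynomial.derivative_C]
  | add p q hp hq => simp only [map_add, hp, hq]
  | mul_X p i hp =>
    have hX : Polynomial.derivative (flow (X i)) = flow (opL (X i)) := by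
      rcases i with k | j
      · exact derivative_flow_cf k
      · rw [opL_xy, flow_xy, Polynomial.derivative_C, map_zero]
    rw [map_mul, Polynomial.derivative_mul, hp, hX, Derivation.leibniz, map_add, smul_eq_mul,
      smul_eq_mul, map_mul, map_mul]
    ring

/-- Taylor's formula at `T = 0`: the `i`-th derivative of `flow f` is `flow (𝓛^i f)`, whose constant
coefficient is `𝓛^i f`. -/
theorem coeff_flow (f : RingAXY) (i : ℕ) :
    (flow f).coeff i = C (1 / (i.factorial : ℝ)) * opL^[i] f := by
  have h : ∀ k : ℕ, Polynomial.derivative^[k] (flow f) = flow (opL^[k] f) := by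
    intro k
    induction k with
    | zero => rfl
    | succ k ih =>
      rw [Function.iterate_succ_apply', Function.iterate_succ_apply', ih, derivative_flow]
  have h1 := congrArg (fun g => Polynomial.coeff g 0) (h i)
  simp only [constantCoeff_flow, Polynomial.coeff_iterate_derivative, zero_add,
    Nat.descFactorial_self] at h1
  rw [← h1, nsmul_eq_mul, ← mul_assoc, ← map_natCast C, ← map_mul,
    one_div_mul_cancel (Nat.cast_ne_zero.mpr i.factorial_ne_zero), map_one, one_mul]

theorem mu_eq_coeff_flow (i : ℕ) : mu i = (flow mu0).coeff i := (coeff_flow _ _).symm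

/-- Specialization of the coefficients to a system `a` and of `x, y` to `x, y`. -/
def specialize (a : Coef → ℝ) : RingAXY →ₐ[ℝ] MvPolynomial (Fin 2) ℝ :=
  aeval (Sum.elim (fun c => C (a c)) X : Coef ⊕ Fin 2 → MvPolynomial (Fin 2) ℝ)

theorem specialize_cf (a : Coef → ℝ) (k : Coef) : specialize a (cf k) = C (a k) := by
  simp [specialize, cf]

theorem specialize_xy (a : Coef → ℝ) (j : Fin 2) : specialize a (X (Sum.inr j)) = X j := by
  simp [specialize]

theorem muAt_eq_coeff (a : Coef → ℝ) (i : ℕ) :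
    muAt a i = ((flow mu0).map (specialize a).toRingHom).coeff i := by
  rw [Polynomial.coeff_map, ← mu_eq_coeff_flow]
  rfl

theorem mu0_eq : mu0 = quadRes (cf a20) (2 * cf a11) (cf a02) (cf b20) (2 * cf b11) (cf b02) :=
  resultant_quadratic _ _ _ _ _ _

/-- The transformed quadratic parts are `P` and `Q` restricted to `Z = T (x Y - y X)`. Expanding
their resultant produces the explicit coefficients `muCoeff`. -/
theorem map_flow_mu0 (a : Coef → ℝ) :
    (flow mu0).map (specialize a).toRingHom =
      ∑ i ∈ Finset.range 5, Polynomial.C (∑ j ∈ Finset.range (i + 1),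
        C (muCoeff a i j) * (X 0 ^ (i - j) * X 1 ^ j)) * Polynomial.X ^ i := by
  have h2 : 2 * (Polynomial.C (C (1 / 2) : MvPolynomial (Fin 2) ℝ)) = 1 := by
    rw [← map_ofNat Polynomial.C 2, ← map_mul, ← map_ofNat C 2, ← map_mul]
    norm_num
  have hc : ∀ f, (specialize a).toRingHom f = specialize a f := fun f => rfl
  have hh : specialize a (C (1 / 2)) = C (1 / 2) := by
    simp [specialize, MvPolynomial.algebraMap_eq]
  have e : ∀ l, flow (cf l) = aeval (R := ℝ) _ (X (Sum.inl l)) := fun l => rfl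
  -- The resultant contains `a11` and `b11` only through their doubles, so the factor `½` can be
  -- removed before `ring` is called.
  have cancel : ∀ u v w : Polynomial (MvPolynomial (Fin 2) ℝ),
      2 * (u + Polynomial.C (C (1 / 2)) * v * Polynomial.X - w) =
        2 * u + v * Polynomial.X - 2 * w := by
    intro u v w
    linear_combination (v * Polynomial.X) * h2
  rw [mu0_eq]
  simp only [quadRes, map_sub, map_mul, map_pow, map_ofNat, e, aeval_X, Sum.elim_inl,
    Polynomial.map_sub, Polynomial.map_mul, Polynomial.map_pow, Polynomial.map_add,
    Polynomial.map_ofNat, Polynomial.map_C, Polynomial.map_X, hc, specialize_cf, specialize_xy, hh,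
    cancel, Finset.sum_range_succ, Finset.sum_range_zero, muCoeff, map_add, map_neg, map_zero]
  ring

theorem muAt_eq (a : Coef → ℝ) {i : ℕ} (hi : i ≤ 4) :
    muAt a i = ∑ j ∈ Finset.range (i + 1), C (muCoeff a i j) * (X 0 ^ (i - j) * X 1 ^ j) := by
  rw [muAt_eq_coeff, map_flow_mu0, Polynomial.finsetSum_coeff]
  simp only [Polynomial.coeff_C_mul_X_pow]
  rw [Finset.sum_ite_eq, if_pos (Finset.mem_range.mpr (by omega))]

theorem isHomogeneous_muAt (a : Coef → ℝ) {i : ℕ} (hi : i ≤ 4) : (muAt a i).IsHomogeneous i := by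
  rw [muAt_eq a hi]
  refine IsHomogeneous.sum _ _ _ fun j hj => ?_
  have h := (isHomogeneous_C (Fin 2) (muCoeff a i j)).mul
    (((isHomogeneous_X ℝ (0 : Fin 2)).pow (i - j)).mul ((isHomogeneous_X ℝ (1 : Fin 2)).pow j))
  have hj' := Finset.mem_range.mp hj
  convert h using 1
  omega

theorem coeff_muAt (a : Coef → ℝ) {i j : ℕ} (hi : i ≤ 4) (hj : j ≤ i) :
    coeff (Finsupp.single 0 (i - j) + Finsupp.single 1 j) (muAt a i) = muCoeff a i j := by
  rw [muAt_eq a hi, coeff_sum]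
  have h : ∀ k, C (muCoeff a i k) * (X 0 ^ (i - k) * X 1 ^ k) =
      monomial (Finsupp.single (0 : Fin 2) (i - k) + Finsupp.single 1 k) (muCoeff a i k) := by
    intro k
    rw [X_pow_eq_monomial, X_pow_eq_monomial, monomial_mul, C_mul_monomial, one_mul, mul_one]
  simp only [h, coeff_monomial]
  rw [Finset.sum_eq_single_of_mem j (Finset.mem_range.mpr (by omega)), if_pos rfl]
  intro k _ hk
  rw [if_neg]
  intro e
  apply hk
  simpa using congrArg (fun f : Fin 2 →₀ ℕ => f 1) e

/-- The coefficient of `x^i` in `μ_i` is `μ_i(1, 0)`, which belongs to the line `Z = T Y`. Once both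
resultants are written by `quadRes`, the claim is a polynomial identity. -/
theorem resQuadratic_X (a : Coef → ℝ) :
    resQuadratic 0 (P a) (Q a) = ∑ i ∈ Finset.range 5,
      C (coeff (Finsupp.single 0 i) (muAt a i)) * (X 1 ^ (4 - i) * X 2 ^ i) := by
  have h : ∀ i ∈ Finset.range 5, C (coeff (Finsupp.single 0 i) (muAt a i)) *
      ((X 1 : MvPolynomial (Fin 3) ℝ) ^ (4 - i) * X 2 ^ i) =
      C (muCoeff a i 0) * (X 1 ^ (4 - i) * X 2 ^ i) := by
    intro i hi
    have hi' := Finset.mem_range.mp hi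
    rw [← coeff_muAt a (by omega) (Nat.zero_le i)]
    simp
  have hp : ∀ c : Fin 6 → ℝ, asPolyIn 0 (C (c 0) * X 2 ^ 2 + C (c 1) * (X 0 * X 2)
      + C (c 2) * (X 1 * X 2) + C (c 3) * X 0 ^ 2 + C (c 4) * (X 0 * X 1) + C (c 5) * X 1 ^ 2) =
      Polynomial.C (C (c 3)) * Polynomial.X ^ 2 +
        Polynomial.C (C (c 4) * X 1 + C (c 1) * X 2) * Polynomial.X +
        Polynomial.C (C (c 5) * X 1 ^ 2 + C (c 2) * (X 1 * X 2) + C (c 0) * X 2 ^ 2) := by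
    intro c
    simp [asPolyIn, Function.update, Polynomial.algebraMap_apply, MvPolynomial.algebraMap_eq]
    ring
  rw [Finset.sum_congr rfl h, resQuadratic]
  have e1 := hp ![a a00, a a10, a a01, a a20, 2 * a a11, a a02]
  have e2 := hp ![a b00, a b10, a b01, a b20, 2 * a b11, a b02]
  rw [show asPolyIn 0 (P a) = _ from e1, show asPolyIn 0 (Q a) = _ from e2, resultant_quadratic]
  simp only [quadRes, Finset.sum_range_succ, Finset.sum_range_zero, muCoeff, map_add, map_sub,
    map_neg, map_mul, map_pow, map_ofNat, Matrix.cons_val]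
  ring

/-- Here `(x, y) = (0, 1)` and the line is `Z = -T X`; this accounts for `(-1)^i`. -/
theorem resQuadratic_Y (a : Coef → ℝ) :
    resQuadratic 1 (P a) (Q a) = ∑ i ∈ Finset.range 5,
      C ((-1) ^ i * coeff (Finsupp.single 1 i) (muAt a i)) * (X 0 ^ (4 - i) * X 2 ^ i) := by
  have h : ∀ i ∈ Finset.range 5, C ((-1) ^ i * coeff (Finsupp.single 1 i) (muAt a i)) *
      ((X 0 : MvPolynomial (Fin 3) ℝ) ^ (4 - i) * X 2 ^ i) =
      C ((-1) ^ i * muCoeff a i i) * (X 0 ^ (4 - i) * X 2 ^ i) := by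
    intro i hi
    have hi' := Finset.mem_range.mp hi
    rw [← coeff_muAt a (by omega) le_rfl]
    simp
  have hp : ∀ c : Fin 6 → ℝ, asPolyIn 1 (C (c 0) * X 2 ^ 2 + C (c 1) * (X 0 * X 2)
      + C (c 2) * (X 1 * X 2) + C (c 3) * X 0 ^ 2 + C (c 4) * (X 0 * X 1) + C (c 5) * X 1 ^ 2) =
      Polynomial.C (C (c 5)) * Polynomial.X ^ 2 +
        Polynomial.C (C (c 4) * X 0 + C (c 2) * X 2) * Polynomial.X +
        Polynomial.C (C (c 3) * X 0 ^ 2 + C (c 1) * (X 0 * X 2) + C (c 0) * X 2 ^ 2) := by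
    intro c
    simp [asPolyIn, Function.update, Polynomial.algebraMap_apply, MvPolynomial.algebraMap_eq]
    ring
  rw [Finset.sum_congr rfl h, resQuadratic]
  have e1 := hp ![a a00, a a10, a a01, a a20, 2 * a a11, a a02]
  have e2 := hp ![a b00, a b10, a b01, a b20, 2 * a b11, a b02]
  rw [show asPolyIn 1 (P a) = _ from e1, show asPolyIn 1 (Q a) = _ from e2, resultant_quadratic]
  simp only [quadRes, Finset.sum_range_succ, Finset.sum_range_zero, muCoeff, map_add, map_sub,
    map_neg, map_mul, map_pow, map_ofNat, map_one, Matrix.cons_val]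
  ring

/-- The expansion of the resultant in `s` of `P(s, 1 + v s, t)` and `Q(s, 1 + v s, t)`. -/
theorem quadRes_direction {R : Type*} [CommRing R] (a : Coef → R) (v t : R) :
    quadRes (a a20 + 2 * a a11 * v + a a02 * v ^ 2)
      (2 * a a11 + 2 * a a02 * v + (a a10 + a a01 * v) * t)
      (a a02 + a a01 * t + a a00 * t ^ 2)
      (a b20 + 2 * a b11 * v + a b02 * v ^ 2)
      (2 * a b11 + 2 * a b02 * v + (a b10 + a b01 * v) * t)
      (a b02 + a b01 * t + a b00 * t ^ 2) =
    ∑ i ∈ Finset.range 5, (∑ j ∈ Finset.range (i + 1), muCoeff a i j * v ^ j) * t ^ i := by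
  simp only [quadRes, Finset.sum_range_succ, Finset.sum_range_zero, muCoeff]
  ring

/-! ### Local multiplicities and finite-dimensional quotients of `ℂ[x, y]` -/

/-- The dimension of the local ring at `c` modulo the extension of the ideal `J`. -/
def localMult (c : Fin 2 → ℂ) (J : Ideal (MvPolynomial (Fin 2) ℂ)) : ℕ∞ :=
  Cardinal.toENat (Module.rank ℂ (LocalRingAt c ⧸ J.map (algebraMap _ (LocalRingAt c))))

theorem affineIntersection_eq_localMult (c : Fin 2 → ℂ) (f g : MvPolynomial (Fin 2) ℂ) :
    affineIntersection c f g = localMult c (Ideal.span {f, g}) := by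
  rw [localMult, Ideal.map_span, Set.image_pair]
  rfl

theorem mem_idealAt {c : Fin 2 → ℂ} {f : MvPolynomial (Fin 2) ℂ} : f ∈ idealAt c ↔ eval c f = 0 :=
  RingHom.mem_ker

theorem idealAt_injective : Function.Injective idealAt := by
  intro c d h
  funext j
  have h1 : X j - C (c j) ∈ idealAt d := by
    rw [← h, mem_idealAt]
    simp
  have h2 := mem_idealAt.mp h1
  simp only [map_sub, eval_X, eval_C] at h2
  exact (sub_eq_zero.mp h2).symm

instance idealAt_isMaximal (c : Fin 2 → ℂ) : (idealAt c).IsMaximal :=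
  RingHom.ker_isMaximal_of_surjective _ fun x => ⟨C x, eval_C x⟩

/-- The Nullstellensatz over `ℂ`. -/
theorem exists_eq_idealAt (I : Ideal (MvPolynomial (Fin 2) ℂ)) [I.IsMaximal] :
    ∃ c, I = idealAt c := by
  obtain ⟨c, hc⟩ := MvPolynomial.isMaximal_iff_eq_vanishingIdeal_singleton.mp
    (inferInstance : I.IsMaximal)
  refine ⟨c, hc.trans ?_⟩
  ext f
  rw [mem_idealAt, mem_vanishingIdeal_singleton_iff]
  rfl

theorem isUnit_algebraMap_of_eval_ne_zero {c : Fin 2 → ℂ} {f : MvPolynomial (Fin 2) ℂ}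
    (h : eval c f ≠ 0) : IsUnit (algebraMap _ (LocalRingAt c) f) :=
  IsLocalization.map_units (LocalRingAt c)
    (⟨f, fun hf => h (mem_idealAt.mp hf)⟩ : (idealAt c).primeCompl)

theorem localMult_eq_zero {c : Fin 2 → ℂ} {J : Ideal (MvPolynomial (Fin 2) ℂ)}
    (h : ¬ J ≤ idealAt c) : localMult c J = 0 := by
  obtain ⟨f, hf, hfc⟩ := SetLike.not_le_iff_exists.mp h
  have htop : J.map (algebraMap _ (LocalRingAt c)) = ⊤ :=
    Ideal.eq_top_of_isUnit_mem _ (Ideal.mem_map_of_mem _ hf)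
      (isUnit_algebraMap_of_eval_ne_zero fun e => hfc (mem_idealAt.mpr e))
  have : Subsingleton (LocalRingAt c ⧸ J.map (algebraMap _ (LocalRingAt c))) :=
    Ideal.Quotient.subsingleton_iff.mpr htop
  rw [localMult, rank_subsingleton', map_zero]

/-- The local ring of `S ⧸ J` at the image of the ideal of `c`. -/
def localizationQuotientEquiv {c : Fin 2 → ℂ} {J : Ideal (MvPolynomial (Fin 2) ℂ)}
    (M : Ideal (MvPolynomial (Fin 2) ℂ ⧸ J)) [M.IsPrime]
    (h : M.comap (Ideal.Quotient.mk J) = idealAt c) :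
    (LocalRingAt c ⧸ J.map (algebraMap _ (LocalRingAt c))) ≃ₗ[ℂ] Localization.AtPrime M := by
  -- Localization commutes with quotients: the complement of `M` is the image of the complement of
  -- the ideal of `c`, so the left side is already a localization of the quotient ring at `M`.
  have hS : Algebra.algebraMapSubmonoid (MvPolynomial (Fin 2) ℂ ⧸ J) (idealAt c).primeCompl =
      M.primeCompl := by
    ext x
    constructor
    · rintro ⟨y, hy, rfl⟩ hx
      apply hy
      rw [← h]
      exact hx
    · intro hx
      obtain ⟨y, rfl⟩ := Ideal.Quotient.mk_surjective x
      refine ⟨y, fun hy => hx ?_, rfl⟩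
      have hy' : y ∈ idealAt c := hy
      rw [← h] at hy'
      exact hy'
  have hL : IsLocalization M.primeCompl
      (LocalRingAt c ⧸ J.map (algebraMap _ (LocalRingAt c))) := by
    rw [← hS]
    infer_instance
  have hT : IsScalarTower ℂ (MvPolynomial (Fin 2) ℂ ⧸ J)
      (LocalRingAt c ⧸ J.map (algebraMap _ (LocalRingAt c))) :=
    IsScalarTower.of_algebraMap_eq (R := ℂ) (S := MvPolynomial (Fin 2) ℂ ⧸ J)
      (A := LocalRingAt c ⧸ J.map (algebraMap _ (LocalRingAt c))) fun _ => rfl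
  exact ((IsLocalization.algEquiv M.primeCompl
    (LocalRingAt c ⧸ J.map (algebraMap _ (LocalRingAt c)))
    (Localization.AtPrime M)).restrictScalars ℂ).toLinearEquiv

/-- The dimension of a finite-dimensional quotient of `ℂ[x, y]` is the sum of the dimensions of its
local rings. -/
theorem exists_finset_sum_localMult (J : Ideal (MvPolynomial (Fin 2) ℂ))
    [Module.Finite ℂ (MvPolynomial (Fin 2) ℂ ⧸ J)] :
    ∃ s : Finset (Fin 2 → ℂ), (∀ c, c ∈ s ↔ J ≤ idealAt c) ∧
      ∑ c ∈ s, localMult c J = (Module.finrank ℂ (MvPolynomial (Fin 2) ℂ ⧸ J) : ℕ∞) := by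
  classical
  set A := MvPolynomial (Fin 2) ℂ ⧸ J
  have hA : IsArtinianRing A := IsArtinianRing.of_finite ℂ A
  have := Fintype.ofFinite (MaximalSpectrum A)
  have hpt : ∀ M : MaximalSpectrum A, ∃ c, M.asIdeal.comap (Ideal.Quotient.mk J) = idealAt c := by
    intro M
    have := M.isMaximal
    have := Ideal.comap_isMaximal_of_surjective (Ideal.Quotient.mk J)
      Ideal.Quotient.mk_surjective (K := M.asIdeal)
    exact exists_eq_idealAt _
  choose pt hpt using hpt
  have hinj : Function.Injective pt := by
    intro M N h
    have h1 := (hpt M).trans ((congrArg idealAt h).trans (hpt N).symm)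
    exact MaximalSpectrum.ext (Ideal.comap_injective_of_surjective _
      Ideal.Quotient.mk_surjective h1)
  refine ⟨Finset.univ.image pt, ?_, ?_⟩
  · intro c
    simp only [Finset.mem_image, Finset.mem_univ, true_and]
    constructor
    · rintro ⟨M, rfl⟩
      rw [← hpt M]
      intro f hf
      rw [Ideal.mem_comap, Ideal.Quotient.eq_zero_iff_mem.mpr hf]
      exact zero_mem _
    · intro hc
      have hker : RingHom.ker (Ideal.Quotient.mk J) ≤ idealAt c := by rwa [Ideal.mk_ker]
      have hmax : ((idealAt c).map (Ideal.Quotient.mk J)).IsMaximal :=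
        Ideal.IsMaximal.map_of_surjective_of_ker_le Ideal.Quotient.mk_surjective hker
      refine ⟨⟨_, hmax⟩, idealAt_injective ?_⟩
      rw [← hpt]
      exact (Ideal.comap_map_of_surjective' _ Ideal.Quotient.mk_surjective _).trans
        (sup_eq_left.mpr hker)
  · rw [Finset.sum_image fun _ _ _ _ h => hinj h]
    -- An Artinian ring is the product of its localizations at its finitely many maximal ideals,
    -- which correspond to the points where `J` vanishes.
    have e := ((MaximalSpectrum.toPiLocalizationEquiv A).restrictScalars ℂ).toLinearEquiv
    have hfin : ∀ M : MaximalSpectrum A, Module.Finite ℂ (Localization.AtPrime M.asIdeal) := by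
      intro M
      have hs := IsArtinianRing.localization_surjective M.asIdeal.primeCompl
        (Localization.AtPrime M.asIdeal)
      exact Module.Finite.of_surjective
        (IsScalarTower.toAlgHom ℂ A (Localization.AtPrime M.asIdeal)).toLinearMap hs
    have h1 : ∀ M : MaximalSpectrum A, localMult (pt M) J =
        (Module.finrank ℂ (Localization.AtPrime M.asIdeal) : ℕ∞) := by
      intro M
      have := M.isMaximal
      rw [localMult, (localizationQuotientEquiv M.asIdeal (hpt M)).rank_eq,
        ← Module.finrank_eq_rank, Cardinal.toENat_nat]
    rw [Finset.sum_congr rfl fun M _ => h1 M, e.finrank_eq, ← Nat.cast_sum]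
    congr 1
    have hfree : ∀ M : MaximalSpectrum A, Module.Free ℂ (Localization.AtPrime M.asIdeal) :=
      fun M => Module.Free.of_divisionRing ℂ (Localization.AtPrime M.asIdeal)
    exact (Module.finrank_pi_fintype ℂ).symm

end QuadSys

/-! ### The quotient of `ℂ[X][Y]` by `(Y² + c Y + e, X^k Y, X^(k+j))` -/

namespace QuadSys

section MonicQuadratic

open Polynomial

/-- The remainder modulo `Y² + c Y + e`, with its coefficients reduced modulo `X ^ (k + j)` and
`X ^ k`. -/
def reducedRemainder (c e : ℂ[X]) (j k : ℕ) : ℂ[X][X] →ₗ[ℂ[X]]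
    (ℂ[X] ⧸ Ideal.span {(X : ℂ[X]) ^ (k + j)}) × (ℂ[X] ⧸ Ideal.span {(X : ℂ[X]) ^ k}) :=
  ((Submodule.mkQ _ ∘ₗ Polynomial.lcoeff ℂ[X] 0).prod (Submodule.mkQ _ ∘ₗ Polynomial.lcoeff ℂ[X] 1)) ∘ₗ
    Polynomial.modByMonicHom (X ^ 2 + C c * X + C e)

theorem monic_quadratic (c e : ℂ[X]) : (X ^ 2 + C c * X + C e : ℂ[X][X]).Monic := by
  monicity!

theorem degree_monic_quadratic (c e : ℂ[X]) : (X ^ 2 + C c * X + C e : ℂ[X][X]).degree = 2 := by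
  compute_degree!

theorem reducedRemainder_eq_zero_iff {c e : ℂ[X]} {j k : ℕ} {h : ℂ[X][X]} :
    reducedRemainder c e j k h = 0 ↔
      X ^ (k + j) ∣ (h %ₘ (X ^ 2 + C c * X + C e)).coeff 0 ∧
      X ^ k ∣ (h %ₘ (X ^ 2 + C c * X + C e)).coeff 1 := by
  rw [Prod.ext_iff]
  exact and_congr ((Submodule.Quotient.mk_eq_zero _).trans Ideal.mem_span_singleton)
    ((Submodule.Quotient.mk_eq_zero _).trans Ideal.mem_span_singleton)

theorem modByMonic_quadratic (c e : ℂ[X]) (h : ℂ[X][X]) :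
    h %ₘ (X ^ 2 + C c * X + C e) = C ((h %ₘ (X ^ 2 + C c * X + C e)).coeff 1) * X +
      C ((h %ₘ (X ^ 2 + C c * X + C e)).coeff 0) := by
  apply Polynomial.eq_X_add_C_of_degree_le_one
  have h1 := degree_modByMonic_lt h (monic_quadratic c e)
  rw [degree_monic_quadratic] at h1
  exact Order.le_of_lt_succ h1

theorem reducedRemainder_surjective (c e : ℂ[X]) (j k : ℕ) :
    Function.Surjective (reducedRemainder c e j k) := by
  rintro ⟨α, β⟩
  obtain ⟨α, rfl⟩ := Submodule.mkQ_surjective _ α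
  obtain ⟨β, rfl⟩ := Submodule.mkQ_surjective _ β
  refine ⟨C β * X + C α, ?_⟩
  have h1 : (C β * X + C α) %ₘ (X ^ 2 + C c * X + C e) = C β * X + C α := by
    rw [modByMonic_eq_self_iff (monic_quadratic c e), degree_monic_quadratic]
    exact degree_linear_le.trans_lt (by norm_num)
  simp [reducedRemainder, modByMonicHom_apply, h1]

/-- The point is that the kernel absorbs multiplication by `Y`: `X^k Y²` reduces to `-X^k (c Y +
e)`, and `X^k e` is divisible by `X^(k+j)` because `X^j ∣ e`. -/
theorem ker_reducedRemainder {c e : ℂ[X]} {j : ℕ} (hj : X ^ j ∣ e) (k : ℕ) :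
    LinearMap.ker (reducedRemainder c e j k) = (Ideal.span {X ^ 2 + C c * X + C e,
      C (X ^ k) * X, C (X ^ (k + j))} : Ideal ℂ[X][X]).restrictScalars ℂ[X] := by
  have hm := monic_quadratic c e
  apply le_antisymm
  · intro h hh
    obtain ⟨⟨α, hα⟩, ⟨β, hβ⟩⟩ := reducedRemainder_eq_zero_iff.mp (LinearMap.mem_ker.mp hh)
    rw [Submodule.restrictScalars_mem]
    have h1 := modByMonic_add_div h (X ^ 2 + C c * X + C e)
    rw [modByMonic_quadratic, hα, hβ] at h1
    refine Ideal.mem_span_insert.mpr ⟨h /ₘ (X ^ 2 + C c * X + C e), _,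
      Ideal.mem_span_pair.mpr ⟨C β, C α, rfl⟩, h1.symm.trans ?_⟩
    simp only [map_mul]
    ring
  · intro h hh
    rw [Submodule.restrictScalars_mem] at hh
    obtain ⟨a, z, hz, rfl⟩ := Ideal.mem_span_insert.mp hh
    obtain ⟨b, d, rfl⟩ := Ideal.mem_span_pair.mp hz
    refine add_mem ?_ (add_mem ?_ ?_)
    · rw [LinearMap.mem_ker, reducedRemainder_eq_zero_iff,
        (modByMonic_eq_zero_iff_dvd hm).mpr (dvd_mul_left _ _)]
      simp
    · have e1 : b * (C (X ^ k) * X) = (X ^ k : ℂ[X]) • (b * X) := by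
        rw [smul_eq_C_mul]; ring
      rw [LinearMap.mem_ker, reducedRemainder_eq_zero_iff, e1, smul_modByMonic]
      simp only [coeff_smul, smul_eq_mul]
      refine ⟨?_, dvd_mul_right _ _⟩
      rw [pow_add]
      refine mul_dvd_mul_left _ (hj.trans ?_)
      -- Comparing constant terms in the division of `b Y` shows that the remainder has constant
      -- term `-e` times that of the quotient.
      have h1 := congrArg (fun f => coeff f 0) (modByMonic_add_div (b * X) (X ^ 2 + C c * X + C e))
      simp only [coeff_add, mul_coeff_zero, coeff_X_zero, mul_zero, coeff_C_zero, coeff_X_pow] at h1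
      norm_num at h1
      exact ⟨_, eq_neg_of_add_eq_zero_left h1 |>.trans (mul_neg _ _).symm⟩
    · have e1 : d * C (X ^ (k + j)) = (X ^ (k + j) : ℂ[X]) • d := by
        rw [smul_eq_C_mul]; ring
      rw [LinearMap.mem_ker, reducedRemainder_eq_zero_iff, e1, smul_modByMonic]
      simp only [coeff_smul, smul_eq_mul]
      exact ⟨dvd_mul_right _ _, (pow_dvd_pow _ (Nat.le_add_right k j)).mul_right _⟩

theorem finite_and_finrank_quotient_X_pow (n : ℕ) :
    Module.Finite ℂ (ℂ[X] ⧸ Ideal.span {(X : ℂ[X]) ^ n}) ∧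
      Module.finrank ℂ (ℂ[X] ⧸ Ideal.span {(X : ℂ[X]) ^ n}) = n := by
  refine ⟨(monic_X_pow n).finite_quotient, ?_⟩
  rw [finrank_quotient_span_eq_natDegree, natDegree_X_pow]

/-- The quotient of `ℂ[X][Y]` by `(Y² + c Y + e, X ^ k Y, X ^ (k + j))`. -/
def quotientQuadraticEquiv {c e : ℂ[X]} {j : ℕ} (hj : X ^ j ∣ e) (k : ℕ) :
    (ℂ[X][X] ⧸ (Ideal.span {X ^ 2 + C c * X + C e, C (X ^ k) * X, C (X ^ (k + j))} :
      Ideal ℂ[X][X])) ≃ₗ[ℂ]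
    (ℂ[X] ⧸ Ideal.span {(X : ℂ[X]) ^ (k + j)}) × (ℂ[X] ⧸ Ideal.span {(X : ℂ[X]) ^ k}) :=
  ((Submodule.quotEquivOfEq _ _ (ker_reducedRemainder hj k).symm).trans
    ((reducedRemainder c e j k).quotKerEquivOfSurjective
      (reducedRemainder_surjective c e j k))).restrictScalars ℂ

end MonicQuadratic

end QuadSys

/-! ### The ideal of a monic quadratic, a linear polynomial and a power of `z` -/

namespace QuadSys

open MvPolynomial Coef

/-- The inclusion of `ℂ[z]` into `ℂ[s, z]`. -/
def zPoly : Polynomial ℂ →ₐ[ℂ] MvPolynomial (Fin 2) ℂ := Polynomial.aeval (X 1)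

/-- The isomorphism `ℂ[s, z] ≃ ℂ[X][Y]` with `z ↦ X` and `s ↦ Y + ρ(X)`. -/
def shiftEquiv (ρ : Polynomial ℂ) :
    MvPolynomial (Fin 2) ℂ ≃ₐ[ℂ] Polynomial (Polynomial ℂ) :=
  AlgEquiv.ofAlgHom
    (aeval ![Polynomial.X + Polynomial.C ρ, Polynomial.C Polynomial.X])
    (Polynomial.eval₂AlgHom zPoly (X 0 - zPoly ρ) fun _ => Commute.all _ _)
    (by
      have h : ∀ f : Polynomial ℂ, aeval ![Polynomial.X + Polynomial.C ρ,
          Polynomial.C (Polynomial.X : Polynomial ℂ)] (zPoly f) = Polynomial.C f := by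
        intro f
        rw [zPoly, ← AlgHom.comp_apply]
        have : (aeval ![Polynomial.X + Polynomial.C ρ,
            Polynomial.C (Polynomial.X : Polynomial ℂ)]).comp
            (Polynomial.aeval (X 1 : MvPolynomial (Fin 2) ℂ)) = Polynomial.CAlgHom (R := ℂ) := by
          ext
          simp
        rw [this]
        rfl
      ext
      · simp [h]
      · simp [h])
    (by
      ext i
      fin_cases i
      · simp
      · simp [zPoly])

theorem shiftEquiv_X_zero (ρ : Polynomial ℂ) :
    shiftEquiv ρ (X 0) = Polynomial.X + Polynomial.C ρ := by
  simp [shiftEquiv]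

theorem shiftEquiv_zPoly (ρ f : Polynomial ℂ) : shiftEquiv ρ (zPoly f) = Polynomial.C f := by
  have h : (shiftEquiv ρ).symm (Polynomial.C f) = zPoly f := by simp [shiftEquiv]
  rw [← h, AlgEquiv.apply_symm_apply]

/-- Putting `s = Y + ρ` turns the quadratic into `Y² + (2 ρ + f₁) Y + (ρ² + f₁ ρ + f₀)`, and the
constant term is divisible by `X^j`. The remainders contribute `(k + j) + k`. -/
theorem finrank_quotient_monic (f₁ f₀ ρ : Polynomial ℂ) {j : ℕ} (k : ℕ)
    (hj : Polynomial.X ^ j ∣ ρ ^ 2 + f₁ * ρ + f₀) :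
    Module.Finite ℂ (MvPolynomial (Fin 2) ℂ ⧸ Ideal.span
      {X 0 ^ 2 + zPoly f₁ * X 0 + zPoly f₀, zPoly (Polynomial.X ^ k) * (X 0 - zPoly ρ),
        zPoly (Polynomial.X ^ (k + j))}) ∧
    Module.finrank ℂ (MvPolynomial (Fin 2) ℂ ⧸ Ideal.span
      {X 0 ^ 2 + zPoly f₁ * X 0 + zPoly f₀, zPoly (Polynomial.X ^ k) * (X 0 - zPoly ρ),
        zPoly (Polynomial.X ^ (k + j))}) = 2 * k + j := by
  have hJ : Ideal.span {Polynomial.X ^ 2 + Polynomial.C (2 * ρ + f₁) * Polynomial.X +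
      Polynomial.C (ρ ^ 2 + f₁ * ρ + f₀), Polynomial.C (Polynomial.X ^ k) * Polynomial.X,
      Polynomial.C (Polynomial.X ^ (k + j))} = (Ideal.span
      {X 0 ^ 2 + zPoly f₁ * X 0 + zPoly f₀, zPoly (Polynomial.X ^ k) * (X 0 - zPoly ρ),
        zPoly (Polynomial.X ^ (k + j))}).map (shiftEquiv ρ : _ →+* _) := by
    rw [Ideal.map_span, Set.image_insert_eq, Set.image_pair]
    simp only [RingHom.coe_coe, map_add, map_mul, map_sub, map_pow, shiftEquiv_X_zero,
      shiftEquiv_zPoly, map_ofNat]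
    have e1 : (Polynomial.X ^ 2 + (2 * Polynomial.C ρ + Polynomial.C f₁) * Polynomial.X +
        (Polynomial.C ρ ^ 2 + Polynomial.C f₁ * Polynomial.C ρ + Polynomial.C f₀) :
        Polynomial (Polynomial ℂ)) = (Polynomial.X + Polynomial.C ρ) ^ 2 +
        Polynomial.C f₁ * (Polynomial.X + Polynomial.C ρ) + Polynomial.C f₀ := by ring
    rw [e1, add_sub_cancel_right]
  have e1 := (Ideal.quotientEquivAlg _ _ (shiftEquiv ρ) hJ).toLinearEquiv.trans
    (quotientQuadraticEquiv hj k)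
  obtain ⟨h1, h2⟩ := finite_and_finrank_quotient_X_pow (k + j)
  obtain ⟨h3, h4⟩ := finite_and_finrank_quotient_X_pow k
  refine ⟨Module.Finite.equiv e1.symm, ?_⟩
  rw [e1.finrank_eq, Module.finrank_prod, h2, h4]
  ring

/-- `X^k` is the common power of `X` in `l₁` and `l₀`. The left side is quadratic in `(l₁, l₀)`, so
cancelling one `X` from both lowers `m` by `2`; `u(0) ≠ 0` forbids this when `m < 2`. -/
theorem exists_pow_X_factor (f₁ f₀ u : Polynomial ℂ) (hu : u.eval 0 ≠ 0) (m : ℕ) :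
    ∀ l₁ l₀ : Polynomial ℂ, l₀ ^ 2 - f₁ * l₀ * l₁ + f₀ * l₁ ^ 2 = Polynomial.X ^ m * u →
    ∃ (k j : ℕ) (n₁ n₀ : Polynomial ℂ), m = 2 * k + j ∧ l₁ = Polynomial.X ^ k * n₁ ∧
      l₀ = Polynomial.X ^ k * n₀ ∧ n₀ ^ 2 - f₁ * n₀ * n₁ + f₀ * n₁ ^ 2 = Polynomial.X ^ j * u ∧
      (n₁.eval 0 ≠ 0 ∨ n₁.eval 0 = 0 ∧ n₀.eval 0 ≠ 0) := by
  induction m using Nat.strong_induction_on with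
  | _ m ih =>
    intro l₁ l₀ h
    by_cases h1 : l₁.eval 0 = 0
    · by_cases h0 : l₀.eval 0 = 0
      · obtain ⟨n₁, rfl⟩ := Polynomial.X_dvd_iff.mpr ((Polynomial.coeff_zero_eq_eval_zero l₁).trans h1)
        obtain ⟨n₀, rfl⟩ := Polynomial.X_dvd_iff.mpr ((Polynomial.coeff_zero_eq_eval_zero l₀).trans h0)
        have hX : (Polynomial.X : Polynomial ℂ) ≠ 0 := Polynomial.X_ne_zero
        match m, ih, h with
        | 0, _, h =>
          have := congrArg (Polynomial.eval 0) h
          simp at this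
          exact absurd this.symm hu
        | 1, _, h =>
          have h2 : Polynomial.X * (n₀ ^ 2 - f₁ * n₀ * n₁ + f₀ * n₁ ^ 2) = u := by
            apply mul_left_cancel₀ hX
            linear_combination h
          rw [← h2] at hu
          simp at hu
        | m + 2, ih, h =>
          obtain ⟨k, j, n₁', n₀', hm, e1, e0, hr, hor⟩ := ih m (by omega) n₁ n₀ (by
            apply mul_left_cancel₀ (pow_ne_zero 2 hX)
            linear_combination h)
          exact ⟨k + 1, j, n₁', n₀', by omega, by rw [e1]; ring, by rw [e0]; ring, hr, hor⟩
      · exact ⟨0, m, l₁, l₀, by omega, by simp, by simp, h, Or.inr ⟨h1, h0⟩⟩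
    · exact ⟨0, m, l₁, l₀, by omega, by simp, by simp, h, Or.inl h1⟩

theorem exists_inverse_mod_X_pow {f : Polynomial ℂ} (hf : f.eval 0 ≠ 0) (n : ℕ) :
    ∃ a b : Polynomial ℂ, a * f + b * Polynomial.X ^ n = 1 := by
  have h : IsCoprime f Polynomial.X := by
    refine (Polynomial.prime_X.coprime_iff_not_dvd.mpr fun h => hf ?_).symm
    rw [← Polynomial.coeff_zero_eq_eval_zero]
    exact Polynomial.X_dvd_iff.mp h
  exact h.pow_right

theorem mem_span_triple_of_eq {R : Type*} [CommRing R] {x y z w : R} (a b c : R)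
    (h : w = a * x + b * y + c * z) : w ∈ Ideal.span {x, y, z} := by
  rw [h]
  exact add_mem (add_mem (Ideal.mul_mem_left _ _ (Ideal.subset_span (by simp)))
    (Ideal.mul_mem_left _ _ (Ideal.subset_span (by simp))))
    (Ideal.mul_mem_left _ _ (Ideal.subset_span (by simp)))

theorem span_triple_le {R : Type*} [CommRing R] {x y z : R} {I : Ideal R} (hx : x ∈ I)
    (hy : y ∈ I) (hz : z ∈ I) : Ideal.span {x, y, z} ≤ I := by
  rw [Ideal.span_le]
  rintro w (rfl | rfl | rfl) <;> assumption

/-- The hypothesis says that the resultant of the quadratic and `l₁ s + l₀` has order `m`. Writing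
`l₁ s + l₀ = z^k (n₁ s + n₀)` with `m = 2 k + j`, the ideal contains `z^(k+j)`. If `n₁` is
invertible modulo `z`, the linear generator can be replaced by `z^k (s - ρ)` with `ρ = -n₀/n₁`;
otherwise `n₀` is invertible and `j = 0`. Both cases fall under `finrank_quotient_monic`. -/
theorem finrank_quotient_linear (f₁ f₀ l₁ l₀ u : Polynomial ℂ) (m : ℕ) (hu : u.eval 0 ≠ 0)
    (h : l₀ ^ 2 - f₁ * l₀ * l₁ + f₀ * l₁ ^ 2 = Polynomial.X ^ m * u) :
    Module.Finite ℂ (MvPolynomial (Fin 2) ℂ ⧸ Ideal.span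
      {X 0 ^ 2 + zPoly f₁ * X 0 + zPoly f₀, zPoly l₁ * X 0 + zPoly l₀,
        zPoly (Polynomial.X ^ m)}) ∧
    Module.finrank ℂ (MvPolynomial (Fin 2) ℂ ⧸ Ideal.span
      {X 0 ^ 2 + zPoly f₁ * X 0 + zPoly f₀, zPoly l₁ * X 0 + zPoly l₀,
        zPoly (Polynomial.X ^ m)}) = m := by
  obtain ⟨k, j, n₁, n₀, rfl, rfl, rfl, hr, hor⟩ := exists_pow_X_factor f₁ f₀ u hu m l₁ l₀ h
  obtain ⟨a', b', hab'⟩ := exists_inverse_mod_X_pow hu (2 * k + j)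
  suffices hρ : ∃ ρ : Polynomial ℂ, Polynomial.X ^ j ∣ ρ ^ 2 + f₁ * ρ + f₀ ∧
      Ideal.span {X 0 ^ 2 + zPoly f₁ * X 0 + zPoly f₀,
        zPoly (Polynomial.X ^ k * n₁) * X 0 + zPoly (Polynomial.X ^ k * n₀),
        zPoly (Polynomial.X ^ (2 * k + j))} = Ideal.span {X 0 ^ 2 + zPoly f₁ * X 0 + zPoly f₀,
        zPoly (Polynomial.X ^ k) * (X 0 - zPoly ρ), zPoly (Polynomial.X ^ (k + j))} by
    obtain ⟨ρ, hj, e⟩ := hρ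
    rw [e]
    exact finrank_quotient_monic f₁ f₀ ρ k hj
  set J := Ideal.span {X 0 ^ 2 + zPoly f₁ * X 0 + zPoly f₀,
        zPoly (Polynomial.X ^ k * n₁) * X 0 + zPoly (Polynomial.X ^ k * n₀),
        zPoly (Polynomial.X ^ (2 * k + j))} with hJ
  have hF : X 0 ^ 2 + zPoly f₁ * X 0 + zPoly f₀ ∈ J := Ideal.subset_span (by simp)
  have hL : zPoly (Polynomial.X ^ k * n₁) * X 0 + zPoly (Polynomial.X ^ k * n₀) ∈ J :=
    Ideal.subset_span (by simp)
  have hX : zPoly (Polynomial.X ^ (2 * k + j)) ∈ J := Ideal.subset_span (by simp)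
  have hr' := congrArg zPoly hr
  have hab2 := congrArg zPoly hab'
  simp only [map_add, map_sub, map_mul, map_pow, map_one] at hr' hab2 hL hX
  -- With `F` the quadratic, `n₁² F - (n₁ s + f₁ n₁ - n₀)(n₁ s + n₀)` equals `z^j u`. Multiply by
  -- `z^k` and by `a'`, the inverse of `u` modulo `z^(2k+j)`.
  have hkj : zPoly (Polynomial.X ^ (k + j)) ∈ J := by
    have e : zPoly (Polynomial.X ^ (k + j)) =
        (zPoly a' * zPoly Polynomial.X ^ k * zPoly n₁ ^ 2) *
          (X 0 ^ 2 + zPoly f₁ * X 0 + zPoly f₀) -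
        (zPoly a' * (zPoly n₁ * X 0 + zPoly f₁ * zPoly n₁ - zPoly n₀)) *
          (zPoly Polynomial.X ^ k * zPoly n₁ * X 0 + zPoly Polynomial.X ^ k * zPoly n₀) +
        (zPoly b' * zPoly Polynomial.X ^ (k + j)) * zPoly Polynomial.X ^ (2 * k + j) := by
      simp only [map_pow]
      linear_combination (-zPoly Polynomial.X ^ (k + j)) * hab2 -
        zPoly a' * zPoly Polynomial.X ^ k * hr'
    rw [e]
    exact add_mem (sub_mem (J.mul_mem_left _ hF) (J.mul_mem_left _ hL)) (J.mul_mem_left _ hX)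
  rcases hor with h1 | ⟨h1, h0⟩
  · obtain ⟨a, b, hab⟩ := exists_inverse_mod_X_pow h1 (2 * k + j)
    have hab1 := congrArg zPoly hab
    simp only [map_add, map_mul, map_pow, map_one] at hab1
    -- Here `a` is the inverse of `n₁` modulo `z^(2k+j)`, so this is the root `-n₀/n₁` of the linear
    -- factor.
    refine ⟨-(a * n₀), ?_, le_antisymm ?_ ?_⟩
    · have hdvd : Polynomial.X ^ j ∣ n₁ ^ 2 * ((-(a * n₀)) ^ 2 + f₁ * (-(a * n₀)) + f₀) := by
        refine ⟨u - (a * n₁ + 1) * b * Polynomial.X ^ (2 * k) * n₀ ^ 2 +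
          f₁ * n₀ * n₁ * b * Polynomial.X ^ (2 * k), ?_⟩
        linear_combination hr + ((a * n₁ + 1) * n₀ ^ 2 - f₁ * n₀ * n₁) * hab
      have hc : IsCoprime (Polynomial.X ^ j) (n₁ ^ 2) := by
        obtain ⟨a2, b2, h2⟩ := exists_inverse_mod_X_pow h1 j
        exact IsCoprime.pow_right ⟨b2, a2, by rw [add_comm, h2]⟩
      exact hc.dvd_of_dvd_mul_left hdvd
    · refine span_triple_le (Ideal.subset_span (by simp))
        (mem_span_triple_of_eq 0 (zPoly n₁)
          (zPoly b * zPoly Polynomial.X ^ (2 * k) * zPoly n₀) ?_)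
        (mem_span_triple_of_eq 0 0 (zPoly Polynomial.X ^ k) ?_)
      · simp only [map_mul, map_neg, map_pow]
        linear_combination (-zPoly Polynomial.X ^ k * zPoly n₀) * hab1
      · simp only [map_pow]
        ring
    · refine span_triple_le hF ?_ hkj
      have e : zPoly (Polynomial.X ^ k) * (X 0 - zPoly (-(a * n₀))) =
          zPoly a * (zPoly Polynomial.X ^ k * zPoly n₁ * X 0 +
            zPoly Polynomial.X ^ k * zPoly n₀) +
          (zPoly b * zPoly Polynomial.X ^ k * X 0) * zPoly Polynomial.X ^ (2 * k + j) := by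
        simp only [map_mul, map_neg, map_pow]
        linear_combination (-zPoly Polynomial.X ^ k * X 0) * hab1
      rw [e]
      exact add_mem (J.mul_mem_left _ hL) (J.mul_mem_left _ hX)
  -- At `z = 0` the relation reads `n₀(0)² = 0^j u(0)`, with nonzero left side.
  · have hj : j = 0 := by
      by_contra hj
      have := congrArg (Polynomial.eval 0) hr
      simp [h1, hj] at this
      exact h0 this
    subst hj
    -- Now `z^k` itself lies in the ideal, so `z^k (s - ρ)` is redundant and any `ρ` would do.
    refine ⟨0, by simp, le_antisymm ?_ ?_⟩
    · obtain ⟨n₁', rfl⟩ := Polynomial.X_dvd_iff.mpr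
        ((Polynomial.coeff_zero_eq_eval_zero n₁).trans h1)
      refine span_triple_le (Ideal.subset_span (by simp))
        (mem_span_triple_of_eq 0 (zPoly (Polynomial.X * n₁')) (zPoly n₀) ?_)
        (mem_span_triple_of_eq 0 0 (zPoly Polynomial.X ^ k) ?_)
      · simp only [map_mul, map_zero, map_pow]
        ring
      · simp only [map_pow]
        ring
    · refine span_triple_le hF ?_ hkj
      have e : zPoly (Polynomial.X ^ k) * (X 0 - zPoly 0) =
          X 0 * zPoly (Polynomial.X ^ (k + 0)) := by
        rw [map_zero, add_zero]
        ring
      rw [e]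
      exact J.mul_mem_left _ hkj

end QuadSys

/-! ### Intersection numbers on `z = 0` and the order of the resultant -/

namespace QuadSys

open MvPolynomial Coef

/-- The polynomial `f₂ s² + f₁(z) s + f₀(z)`. -/
def quadPoly (f₂ : ℂ) (f₁ f₀ : Polynomial ℂ) : MvPolynomial (Fin 2) ℂ :=
  C f₂ * X 0 ^ 2 + zPoly f₁ * X 0 + zPoly f₀

theorem zPoly_C (r : ℂ) : zPoly (Polynomial.C r) = C r := by
  simp [zPoly, MvPolynomial.algebraMap_eq]

theorem eval_zPoly (c : Fin 2 → ℂ) (f : Polynomial ℂ) : eval c (zPoly f) = f.eval (c 1) := by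
  have h : (aeval c).comp zPoly = Polynomial.aeval (c 1) := by
    ext
    simp [zPoly]
  have h1 := congrArg (fun φ : Polynomial ℂ →ₐ[ℂ] ℂ => φ f) h
  rwa [AlgHom.comp_apply, MvPolynomial.aeval_eq_eval, Polynomial.coe_aeval_eq_eval] at h1

theorem affineIntersection_comm (c : Fin 2 → ℂ) (f g : MvPolynomial (Fin 2) ℂ) :
    affineIntersection c f g = affineIntersection c g f := by
  rw [affineIntersection_eq_localMult, affineIntersection_eq_localMult, Set.pair_comm]

theorem quadRes_comm {R : Type*} [CommRing R] (f₂ f₁ f₀ g₂ g₁ g₀ : R) :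
    quadRes f₂ f₁ f₀ g₂ g₁ g₀ = quadRes g₂ g₁ g₀ f₂ f₁ f₀ := by
  simp only [quadRes]
  ring

/-- Subtracting `(g₂/f₂) F` from `G` leaves `L = l₁ s + l₀`. At a point of `z = 0` the factor `u` is
a unit, so the resultant puts `z^m` into the local ideal `(F, G)`, which thus equals that of `J =
(F/f₂, L, z^m)`. All zeros of `J` lie on `z = 0`, so its local dimensions add up to its global
dimension `m`. -/
theorem sum_affineIntersection_of_ne_zero {f₂ g₂ : ℂ} {f₁ f₀ g₁ g₀ u : Polynomial ℂ} {m : ℕ}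
    (hf : f₂ ≠ 0) (hu : u.eval 0 ≠ 0)
    (h : quadRes (Polynomial.C f₂) f₁ f₀ (Polynomial.C g₂) g₁ g₀ = Polynomial.X ^ m * u) :
    ∃ s : Finset ℂ,
      ∑ t ∈ s, affineIntersection ![t, 0] (quadPoly f₂ f₁ f₀) (quadPoly g₂ g₁ g₀) = m ∧
      ∀ t ∉ s, affineIntersection ![t, 0] (quadPoly f₂ f₁ f₀) (quadPoly g₂ g₁ g₀) = 0 := by
  classical
  set F := quadPoly f₂ f₁ f₀ with hF
  set G := quadPoly g₂ g₁ g₀ with hG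
  set i : Polynomial ℂ := Polynomial.C f₂⁻¹ with hi
  have hif : i * Polynomial.C f₂ = 1 := by rw [hi, ← map_mul, inv_mul_cancel₀ hf, map_one]
  set l₁ := g₁ - Polynomial.C g₂ * i * f₁ with hl₁
  set l₀ := g₀ - Polynomial.C g₂ * i * f₀ with hl₀
  have hres : l₀ ^ 2 - (i * f₁) * l₀ * l₁ + (i * f₀) * l₁ ^ 2 =
      Polynomial.X ^ m * (i ^ 2 * u) := by
    have : Polynomial.X ^ m * (i ^ 2 * u) = i ^ 2 *
        quadRes (Polynomial.C f₂) f₁ f₀ (Polynomial.C g₂) g₁ g₀ := by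
      rw [h]
      ring
    rw [this, quadRes, hl₁, hl₀]
    linear_combination (-(g₀ ^ 2 * (i * Polynomial.C f₂ + 1)) + 2 * i * f₀ * Polynomial.C g₂ * g₀
      + f₁ * g₀ * g₁ * i - f₀ * g₁ ^ 2 * i) * hif
  have hu' : (i ^ 2 * u).eval 0 ≠ 0 := by
    rw [Polynomial.eval_mul, Polynomial.eval_pow, hi, Polynomial.eval_C]
    exact mul_ne_zero (pow_ne_zero _ (inv_ne_zero hf)) hu
  obtain ⟨hfin, hrank⟩ := finrank_quotient_linear (i * f₁) (i * f₀) l₁ l₀ _ m hu' hres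
  set J := Ideal.span {X 0 ^ 2 + zPoly (i * f₁) * X 0 + zPoly (i * f₀),
    zPoly l₁ * X 0 + zPoly l₀, zPoly (Polynomial.X ^ m)} with hJ
  have hif' := congrArg zPoly hif
  simp only [map_mul, map_one, zPoly_C] at hif'
  have hFJ : F ∈ J := mem_span_triple_of_eq (C f₂) 0 0 (by
    rw [hF, quadPoly, map_mul, map_mul]
    linear_combination (-(zPoly f₁ * X 0 + zPoly f₀)) * hif')
  have hGJ : G ∈ J := mem_span_triple_of_eq (C g₂) 1 0 (by
    rw [hG, quadPoly, hl₁, hl₀]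
    simp only [map_mul, map_sub, zPoly_C]
    ring)
  have hle : Ideal.span {F, G} ≤ J := by
    rw [Ideal.span_le]
    rintro w (rfl | rfl) <;> assumption
  have hFmem : F ∈ Ideal.span {F, G} := Ideal.subset_span (by simp)
  have hGmem : G ∈ Ideal.span {F, G} := Ideal.subset_span (by simp)
  -- The resultant is a combination of the two polynomials, here up to the constant `f₂⁻²`.
  have hres_mem : zPoly (Polynomial.X ^ m * (i ^ 2 * u)) ∈ Ideal.span {F, G} := by
    have e : zPoly (Polynomial.X ^ m * (i ^ 2 * u)) = (zPoly i * zPoly l₁ ^ 2) * F -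
        (zPoly l₁ * X 0 + zPoly (i * f₁) * zPoly l₁ - zPoly l₀) *
          (G - (C g₂ * zPoly i) * F) := by
      rw [← hres, hF, hG, quadPoly, quadPoly]
      have e1 : zPoly g₁ = zPoly l₁ + C g₂ * zPoly i * zPoly f₁ := by
        rw [hl₁]
        simp only [map_mul, map_sub, zPoly_C]
        ring
      have e0 : zPoly g₀ = zPoly l₀ + C g₂ * zPoly i * zPoly f₀ := by
        rw [hl₀]
        simp only [map_mul, map_sub, zPoly_C]
        ring
      rw [e1, e0]
      simp only [map_mul, map_add, map_sub, map_pow]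
      linear_combination (-(zPoly l₁ ^ 2 * X 0 ^ 2) - (zPoly l₁ * X 0 +
        zPoly i * zPoly f₁ * zPoly l₁ - zPoly l₀) * C g₂ * X 0 ^ 2) * hif'
    rw [e]
    exact sub_mem (Ideal.mul_mem_left _ _ hFmem)
      (Ideal.mul_mem_left _ _ (sub_mem hGmem (Ideal.mul_mem_left _ _ hFmem)))
  have hlocal : ∀ c : Fin 2 → ℂ, c 1 = 0 → affineIntersection c F G = localMult c J := by
    intro c hc
    rw [affineIntersection_eq_localMult, localMult, localMult]
    have e : (Ideal.span {F, G}).map (algebraMap _ (LocalRingAt c)) =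
        J.map (algebraMap _ (LocalRingAt c)) := by
      refine le_antisymm (Ideal.map_mono hle) ?_
      rw [Ideal.map_le_iff_le_comap]
      refine span_triple_le ?_ ?_ ?_
      · have e1 : X 0 ^ 2 + zPoly (i * f₁) * X 0 + zPoly (i * f₀) = zPoly i * F := by
          rw [hF, quadPoly, map_mul, map_mul]
          linear_combination (-(X 0 ^ 2)) * hif'
        rw [e1]
        exact Ideal.mem_comap.mpr (Ideal.mem_map_of_mem _ (Ideal.mul_mem_left _ _ hFmem))
      · have e1 : zPoly l₁ * X 0 + zPoly l₀ = G - (C g₂ * zPoly i) * F := by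
          rw [hF, hG, quadPoly, quadPoly, hl₁, hl₀]
          simp only [map_mul, map_sub, zPoly_C]
          linear_combination (C g₂ * X 0 ^ 2) * hif'
        rw [e1]
        exact Ideal.mem_comap.mpr
          (Ideal.mem_map_of_mem _ (sub_mem hGmem (Ideal.mul_mem_left _ _ hFmem)))
      · have hunit : IsUnit (algebraMap _ (LocalRingAt c) (zPoly (i ^ 2 * u))) := by
          apply isUnit_algebraMap_of_eval_ne_zero
          rwa [eval_zPoly, hc]
        have h1 := Ideal.mem_map_of_mem (algebraMap _ (LocalRingAt c)) hres_mem
        rw [map_mul, map_mul] at h1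
        exact Ideal.mem_comap.mpr ((Ideal.mul_unit_mem_iff_mem _ hunit).mp h1)
    rw [e]
  obtain ⟨s, hs, hsum⟩ := exists_finset_sum_localMult J
  have hs0 : ∀ c ∈ s, c = ![c 0, 0] := by
    intro c hc
    have h1 := mem_idealAt.mp ((hs c).mp hc (Ideal.subset_span (by simp) :
      zPoly (Polynomial.X ^ m) ∈ J))
    rw [eval_zPoly, Polynomial.eval_pow, Polynomial.eval_X] at h1
    have h2 : c 1 = 0 := eq_zero_of_pow_eq_zero h1
    funext j
    fin_cases j
    · rfl
    · exact h2
  refine ⟨s.image fun c => c 0, ?_, ?_⟩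
  · rw [Finset.sum_image, ← hrank, ← hsum]
    · refine Finset.sum_congr rfl fun c hc => ?_
      rw [← hs0 c hc]
      exact hlocal c (by rw [hs0 c hc]; rfl)
    · intro c hc d hd hcd
      rw [hs0 c hc, hs0 d hd, show c 0 = d 0 from hcd]
  · intro t ht
    rw [hlocal _ rfl]
    refine localMult_eq_zero fun hle => ht ?_
    exact Finset.mem_image.mpr ⟨_, (hs _).mpr hle, rfl⟩

/-- The intersection numbers of two curves `f₂ s² + f₁(z) s + f₀(z) = 0` at the points of the line
`z = 0` add up to the order of their resultant at `z = 0`. -/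
theorem sum_affineIntersection {f₂ g₂ : ℂ} {f₁ f₀ g₁ g₀ u : Polynomial ℂ} {m : ℕ}
    (hf : f₂ ≠ 0 ∨ g₂ ≠ 0) (hu : u.eval 0 ≠ 0)
    (h : quadRes (Polynomial.C f₂) f₁ f₀ (Polynomial.C g₂) g₁ g₀ = Polynomial.X ^ m * u) :
    ∃ s : Finset ℂ,
      ∑ t ∈ s, affineIntersection ![t, 0] (quadPoly f₂ f₁ f₀) (quadPoly g₂ g₁ g₀) = m ∧
      ∀ t ∉ s, affineIntersection ![t, 0] (quadPoly f₂ f₁ f₀) (quadPoly g₂ g₁ g₀) = 0 := by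
  rcases hf with hf | hg
  · exact sum_affineIntersection_of_ne_zero hf hu h
  · rw [quadRes_comm] at h
    simp only [affineIntersection_comm _ (quadPoly f₂ f₁ f₀)]
    exact sum_affineIntersection_of_ne_zero hg hu h

end QuadSys

/-! ### Nonvanishing of the resultant of coprime quadratics -/

namespace QuadSys

open Polynomial

/-- With `L = f₂ G - g₂ F` of degree at most `1`, a zero resultant gives `l₁² F = L K` with `K` of
degree at most `1`. As `F` is coprime to `L`, it divides `K`, so `K = 0` by degree. Then `L = 0`,
and `F`, being coprime to `0`, would be a unit of degree `2`. -/
theorem quadRes_ne_zero_of_isUnit {R : Type*} [CommRing R] [IsDomain R]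
    [UniqueFactorizationMonoid R] {f₂ f₁ f₀ g₂ g₁ g₀ : R} (hf : IsUnit f₂)
    (h : IsRelPrime (C f₂ * X ^ 2 + C f₁ * X + C f₀) (C g₂ * X ^ 2 + C g₁ * X + C g₀)) :
    quadRes f₂ f₁ f₀ g₂ g₁ g₀ ≠ 0 := by
  intro hR
  set F := C f₂ * X ^ 2 + C f₁ * X + C f₀ with hF
  set G := C g₂ * X ^ 2 + C g₁ * X + C g₀ with hG
  have hdeg : F.degree = 2 := degree_quadratic hf.ne_zero
  have hF0 : F ≠ 0 := by
    intro e
    simp [e] at hdeg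
  set l₁ := f₂ * g₁ - g₂ * f₁ with hl₁
  set l₀ := f₂ * g₀ - g₂ * f₀ with hl₀
  set L := C l₁ * X + C l₀ with hL
  set K := C (f₂ * l₁) * X + C (f₁ * l₁ - f₂ * l₀) with hK
  have hLG : L = C f₂ * G - C g₂ * F := by
    rw [hL, hG, hF, hl₁, hl₀]
    simp only [map_sub, map_mul]
    ring
  -- The difference of the two sides is `f₂` times the resultant.
  have hmul : C l₁ ^ 2 * F = L * K := by
    have h1 := congrArg C hR
    rw [hL, hF, hK, hl₁, hl₀]
    simp only [quadRes, map_sub, map_mul, map_pow, map_zero] at h1 ⊢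
    linear_combination (C f₂) * h1
  have hrel : IsRelPrime F L := by
    intro d hd hdL
    refine h hd ?_
    have h1 : d ∣ C f₂ * G := by
      have := dvd_add hdL (hd.mul_left (C g₂))
      rwa [hLG, sub_add_cancel] at this
    exact ((hf.map C).dvd_mul_left).mp h1
  have hFK : F ∣ K := hrel.dvd_of_dvd_mul_left (Dvd.intro_left _ hmul)
  have hK0 : K = 0 := by
    by_contra hK0
    have h1 := degree_le_of_dvd hFK hK0
    rw [hdeg] at h1
    have h2 : K.degree ≤ 1 := degree_linear_le
    exact absurd (h1.trans h2) (by norm_num)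
  have hl₁0 : l₁ = 0 := by
    rw [hK0, mul_zero] at hmul
    have h1 := (mul_eq_zero.mp hmul).resolve_right hF0
    exact C_eq_zero.mp (pow_eq_zero_iff two_ne_zero |>.mp h1)
  have hl₀0 : l₀ = 0 := by
    have h1 := congrArg (fun f => coeff f 0) hK0
    simp only [hK, hl₁0, mul_zero, zero_sub, map_zero, zero_mul, zero_add, coeff_C_zero,
      coeff_zero, neg_eq_zero] at h1
    exact (mul_eq_zero.mp h1).resolve_left hf.ne_zero
  have hu : IsUnit F := hrel dvd_rfl (by rw [hL, hl₁0, hl₀0]; simp)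
  rw [degree_eq_zero_of_isUnit hu] at hdeg
  exact absurd hdeg (by norm_num)

theorem quadRes_ne_zero {R : Type*} [CommRing R] [IsDomain R]
    [UniqueFactorizationMonoid R] {f₂ f₁ f₀ g₂ g₁ g₀ : R} (hfg : IsUnit f₂ ∨ IsUnit g₂)
    (h : IsRelPrime (C f₂ * X ^ 2 + C f₁ * X + C f₀) (C g₂ * X ^ 2 + C g₁ * X + C g₀)) :
    quadRes f₂ f₁ f₀ g₂ g₁ g₀ ≠ 0 := by
  rcases hfg with hf | hg
  · exact quadRes_ne_zero_of_isUnit hf h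
  · rw [quadRes_comm]
    exact quadRes_ne_zero_of_isUnit hg h.symm

end QuadSys

/-! ### Comparison of charts and the line at infinity -/

namespace QuadSys

open MvPolynomial Coef

/-- Evaluation at `c` on the local ring at `c`. -/
def residueAt (c : Fin 2 → ℂ) : LocalRingAt c →ₐ[ℂ] ℂ :=
  IsLocalization.liftAlgHom (M := (idealAt c).primeCompl) (f := aeval c) fun y =>
    IsUnit.mk0 _ fun h => y.2 (mem_idealAt.mpr (by rwa [aeval_eq_eval] at h))

theorem residueAt_algebraMap (c : Fin 2 → ℂ) (f : MvPolynomial (Fin 2) ℂ) :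
    residueAt c (algebraMap _ _ f) = eval c f := by
  simp [residueAt]

theorem isUnit_of_residueAt_ne_zero {c : Fin 2 → ℂ} {x : LocalRingAt c} (h : residueAt c x ≠ 0) :
    IsUnit x := by
  obtain ⟨f, y, rfl⟩ := IsLocalization.exists_mk'_eq (idealAt c).primeCompl x
  rw [IsLocalization.AtPrime.isUnit_mk'_iff _ (idealAt c)]
  intro hf
  apply h
  have h1 := congrArg (residueAt c) (IsLocalization.mk'_spec (LocalRingAt c) f y)
  rw [map_mul, residueAt_algebraMap, residueAt_algebraMap, mem_idealAt.mp hf] at h1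
  exact (mul_eq_zero.mp h1).resolve_right fun e => y.2 (mem_idealAt.mpr e)

theorem residueAt_algHom {c d : Fin 2 → ℂ} (φ : MvPolynomial (Fin 2) ℂ →ₐ[ℂ] LocalRingAt d)
    (h : ∀ j, residueAt d (φ (X j)) = c j) (f : MvPolynomial (Fin 2) ℂ) :
    residueAt d (φ f) = eval c f := by
  have h1 : (residueAt d).comp φ = aeval c := by
    ext j
    simp [h]
  rw [← AlgHom.comp_apply, h1, aeval_eq_eval]

/-- The homomorphism of local rings induced by a map of the coordinates. -/
def liftLocal {c d : Fin 2 → ℂ} (φ : MvPolynomial (Fin 2) ℂ →ₐ[ℂ] LocalRingAt d)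
    (h : ∀ j, residueAt d (φ (X j)) = c j) : LocalRingAt c →ₐ[ℂ] LocalRingAt d :=
  IsLocalization.liftAlgHom (M := (idealAt c).primeCompl) (f := φ) fun y =>
    isUnit_of_residueAt_ne_zero fun e => y.2 (mem_idealAt.mpr ((residueAt_algHom φ h y).symm.trans e))

theorem liftLocal_algebraMap {c d : Fin 2 → ℂ} (φ : MvPolynomial (Fin 2) ℂ →ₐ[ℂ] LocalRingAt d)
    (h : ∀ j, residueAt d (φ (X j)) = c j) (f : MvPolynomial (Fin 2) ℂ) :
    liftLocal φ h (algebraMap _ _ f) = φ f := by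
  simp [liftLocal]

theorem localRing_algHom_ext {c : Fin 2 → ℂ} {A : Type*} [CommRing A] [Algebra ℂ A]
    {φ ψ : LocalRingAt c →ₐ[ℂ] A}
    (h : ∀ j, φ (algebraMap (MvPolynomial (Fin 2) ℂ) _ (X j)) =
      ψ (algebraMap (MvPolynomial (Fin 2) ℂ) _ (X j))) : φ = ψ := by
  apply IsLocalization.algHom_ext (idealAt c).primeCompl
  ext j
  exact h j

theorem affineIntersection_congr {c d : Fin 2 → ℂ} (e : LocalRingAt c ≃ₐ[ℂ] LocalRingAt d)
    {f g f' g' : MvPolynomial (Fin 2) ℂ} {r : LocalRingAt d} (hr : IsUnit r)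
    (hf : e (algebraMap _ _ f) = r * algebraMap _ _ f')
    (hg : e (algebraMap _ _ g) = r * algebraMap _ _ g') :
    affineIntersection c f g = affineIntersection d f' g' := by
  have h : (Ideal.span {algebraMap _ (LocalRingAt d) f', algebraMap _ (LocalRingAt d) g'} :
      Ideal (LocalRingAt d)) = (Ideal.span {algebraMap _ (LocalRingAt c) f,
        algebraMap _ (LocalRingAt c) g}).map (e : LocalRingAt c →+* LocalRingAt d) := by
    rw [Ideal.map_span, Set.image_pair, Ideal.span_insert, Ideal.span_insert]
    congr 1
    · exact (Ideal.span_singleton_mul_left_unit hr _).symm.trans (congrArg _ (by rw [← hf]; rfl))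
    · exact (Ideal.span_singleton_mul_left_unit hr _).symm.trans (congrArg _ (by rw [← hg]; rfl))
  rw [affineIntersection, affineIntersection]
  exact congrArg _ (Ideal.quotientEquivAlg _ _ e h).toLinearEquiv.rank_eq

/-- The coordinates of the chart `X i = 1`. -/
def stdChart (i : Fin 3) : Fin 3 → MvPolynomial (Fin 2) ℂ := i.insertNth 1 fun j => X j

/-- The coordinates of the chart `Y - v X = 1`. -/
def skewChart (v : ℂ) : Fin 3 → MvPolynomial (Fin 2) ℂ := ![X 0, 1 + C v * X 0, X 1]

theorem aeval_smul_of_isHomogeneous {A : Type*} [CommRing A] [Algebra ℂ A]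
    {F : MvPolynomial (Fin 3) ℂ} {n : ℕ} (hF : F.IsHomogeneous n) (r : A) (w : Fin 3 → A) :
    aeval (fun k => r * w k) F = r ^ n * aeval w F := by
  rw [aeval_def, aeval_def, eval₂_eq, eval₂_eq, Finset.mul_sum]
  refine Finset.sum_congr rfl fun d hd => ?_
  have h : ∑ k ∈ d.support, d k = n := by
    have h1 := hF (mem_support_iff.mp hd)
    simpa [Finsupp.weight_apply, Finsupp.sum] using h1
  simp only [mul_pow]
  rw [Finset.prod_mul_distrib, Finset.prod_pow_eq_pow_sum, h]
  ring

theorem eval_stdChart {i : Fin 3} {w : Fin 3 → ℂ} (hi : w i ≠ 0) (k : Fin 3) :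
    eval (fun j => w (i.succAbove j) / w i) (stdChart i k) = (w i)⁻¹ * w k := by
  rcases Fin.eq_self_or_eq_succAbove i k with rfl | ⟨j, rfl⟩
  · simp [stdChart, hi]
  · simp [stdChart, div_eq_inv_mul]

theorem eval_skewChart {v : ℂ} {w : Fin 3 → ℂ} (hw : w 2 = 0) (h : w 1 - v * w 0 ≠ 0)
    (k : Fin 3) :
    eval ![w 0 / (w 1 - v * w 0), 0] (skewChart v k) = (w 1 - v * w 0)⁻¹ * w k := by
  fin_cases k
  · simp [skewChart, div_eq_inv_mul]
  · simp [skewChart]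
    field_simp
    ring
  · simp [skewChart, hw]

/-- The homogeneous coordinates in the two charts are proportional up to units of the local rings.
The resulting substitutions are mutually inverse isomorphisms of local rings, and a form of degree
`n` only acquires the unit `r^n`, which does not change the ideal. -/
theorem affineIntersection_stdChart {F G : MvPolynomial (Fin 3) ℂ} {n : ℕ}
    (hF : F.IsHomogeneous n) (hG : G.IsHomogeneous n) {v : ℂ} {w : Fin 3 → ℂ} (hw : w 2 = 0)
    (h : w 1 - v * w 0 ≠ 0) {i : Fin 3} (hi : w i ≠ 0) :
    affineIntersection (fun j => w (i.succAbove j) / w i) (dehomogenize i F) (dehomogenize i G) =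
      affineIntersection ![w 0 / (w 1 - v * w 0), 0] (aeval (skewChart v) F)
        (aeval (skewChart v) G) := by
  set c : Fin 2 → ℂ := fun j => w (i.succAbove j) / w i with hc
  set d : Fin 2 → ℂ := ![w 0 / (w 1 - v * w 0), 0] with hd
  set V : Fin 3 → LocalRingAt c := fun k => algebraMap _ _ (stdChart i k) with hV
  set U : Fin 3 → LocalRingAt d := fun k => algebraMap _ _ (skewChart v k) with hU
  have hVi : V i = 1 := by simp [hV, stdChart]
  have hVj : ∀ j, V (i.succAbove j) = algebraMap (MvPolynomial (Fin 2) ℂ) _ (X j) := by simp [hV, stdChart]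
  have hU1 : U 1 = 1 + algebraMap ℂ _ v * U 0 := by
    have e : algebraMap ℂ (LocalRingAt d) v = algebraMap (MvPolynomial (Fin 2) ℂ) _ (C v) :=
      IsScalarTower.algebraMap_apply ℂ (MvPolynomial (Fin 2) ℂ) (LocalRingAt d) v
    rw [e]
    simp [hU, skewChart]
  have hrV : ∀ k, residueAt c (V k) = (w i)⁻¹ * w k := fun k =>
    (residueAt_algebraMap _ _).trans (eval_stdChart hi k)
  have hrU : ∀ k, residueAt d (U k) = (w 1 - v * w 0)⁻¹ * w k := fun k =>
    (residueAt_algebraMap _ _).trans (eval_skewChart hw h k)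
  have hUi : IsUnit (U i) := isUnit_of_residueAt_ne_zero (by
    rw [hrU]
    exact mul_ne_zero (inv_ne_zero h) hi)
  have hVv : IsUnit (V 1 - algebraMap ℂ _ v * V 0) := isUnit_of_residueAt_ne_zero (by
    rw [map_sub, map_mul, hrV, hrV, AlgHom.commutes, Algebra.algebraMap_self_apply]
    have : (w i)⁻¹ * w 1 - v * ((w i)⁻¹ * w 0) = (w i)⁻¹ * (w 1 - v * w 0) := by ring
    rw [this]
    exact mul_ne_zero (inv_ne_zero hi) h)
  -- The transition factors: `r = 1 / U i` normalizes the `i`-th coordinate to `1`, and `t = 1 / (V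
  -- 1 - v V 0)` normalizes `Y - v X` to `1`.
  obtain ⟨r, hr⟩ := hUi.exists_left_inv
  obtain ⟨t, ht⟩ := hVv.exists_left_inv
  have hrr : residueAt d r * ((w 1 - v * w 0)⁻¹ * w i) = 1 := by
    rw [← hrU, ← map_mul, hr, map_one]
  have htt : residueAt c t * ((w i)⁻¹ * (w 1 - v * w 0)) = 1 := by
    have := congrArg (residueAt c) ht
    rw [map_mul, map_sub, map_mul, hrV, hrV, AlgHom.commutes, Algebra.algebraMap_self_apply,
      map_one] at this
    rw [← this]
    ring
  have hα : ∀ j, residueAt d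
      (aeval (fun j => r * U (i.succAbove j)) (X j : MvPolynomial (Fin 2) ℂ)) = c j := by
    intro j
    rw [aeval_X, map_mul, hrU, hc]
    have h1 : residueAt d r = (w 1 - v * w 0) / w i := by
      field_simp at hrr ⊢
      linear_combination hrr
    rw [h1]
    field_simp
  have hβ : ∀ j, residueAt c
      (aeval ![t * V 0, t * V 2] (X j : MvPolynomial (Fin 2) ℂ)) = d j := by
    have h1 : residueAt c t = w i / (w 1 - v * w 0) := by
      field_simp at htt ⊢
      linear_combination htt
    intro j
    rw [aeval_X]
    fin_cases j
    · change residueAt c (t * V 0) = w 0 / (w 1 - v * w 0)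
      rw [map_mul, hrV, h1]
      field_simp
    · change residueAt c (t * V 2) = 0
      rw [map_mul, hrV, hw, mul_zero, mul_zero]
  set α := liftLocal _ hα with hαd
  set β := liftLocal _ hβ with hβd
  have hαV : ∀ k, α (V k) = r * U k := by
    intro k
    rcases Fin.eq_self_or_eq_succAbove i k with rfl | ⟨j, rfl⟩
    · rw [hVi, map_one, hr]
    · rw [hVj, hαd, liftLocal_algebraMap, aeval_X]
  have hU0 : U 0 = algebraMap (MvPolynomial (Fin 2) ℂ) _ (X 0) := rfl
  have hU2 : U 2 = algebraMap (MvPolynomial (Fin 2) ℂ) _ (X 1) := rfl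
  have hβ0 : β (U 0) = t * V 0 := by
    rw [hU0, hβd, liftLocal_algebraMap, aeval_X]
    rfl
  have hβU : ∀ k, β (U k) = t * V k := by
    intro k
    fin_cases k
    · exact hβ0
    · change β (U 1) = t * V 1
      rw [hU1, map_add, map_mul, map_one, AlgHom.commutes, hβ0]
      linear_combination -ht
    · change β (U 2) = t * V 2
      rw [hU2, hβd, liftLocal_algebraMap, aeval_X]
      rfl
  have hβr : β r * t = 1 := by
    have := congrArg β hr
    rwa [map_mul, hβU, hVi, mul_one, map_one] at this
  have hαt : α t * r = 1 := by
    have := congrArg α ht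
    rw [map_mul, map_sub, map_mul, hαV, hαV, AlgHom.commutes, map_one, hU1] at this
    rw [← this]
    ring
  have hβα : β.comp α = AlgHom.id ℂ _ := by
    apply localRing_algHom_ext
    intro j
    rw [← hVj, AlgHom.comp_apply, hαV, map_mul, hβU, ← mul_assoc, hβr, one_mul]
    rfl
  have hαβ : α.comp β = AlgHom.id ℂ _ := by
    apply localRing_algHom_ext
    have key : ∀ k, (α.comp β) (U k) = U k := by
      intro k
      rw [AlgHom.comp_apply, hβU, map_mul, hαV, ← mul_assoc, hαt, one_mul]
    intro j
    fin_cases j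
    · exact key 0
    · exact key 2
  have hform : ∀ {H : MvPolynomial (Fin 3) ℂ}, H.IsHomogeneous n →
      α (algebraMap _ _ (dehomogenize i H)) = r ^ n * algebraMap _ _ (aeval (skewChart v) H) := by
    intro H hH
    have h1 : algebraMap _ (LocalRingAt d) (aeval (skewChart v) H) = aeval U H := by
      rw [← IsScalarTower.toAlgHom_apply ℂ, ← AlgHom.comp_apply, comp_aeval]
      rfl
    have h2 : α (algebraMap _ _ (dehomogenize i H)) = aeval (fun k => r * U k) H := by
      rw [← IsScalarTower.toAlgHom_apply ℂ, dehomogenize, ← AlgHom.comp_apply, ← AlgHom.comp_apply,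
        comp_aeval]
      congr 2
      funext k
      exact hαV k
    rw [h1, h2, aeval_smul_of_isHomogeneous hH]
  exact affineIntersection_congr (AlgEquiv.ofAlgHom α β hαβ hβα)
    ((IsUnit.of_mul_eq_one _ hr).pow n) (hform hF) (hform hG)

theorem isHomogeneous_ternary {R : Type*} [CommRing R] (c : Fin 6 → R) :
    (C (c 0) * X 2 ^ 2 + C (c 1) * (X 0 * X 2) + C (c 2) * (X 1 * X 2) + C (c 3) * X 0 ^ 2
      + C (c 4) * (X 0 * X 1) + C (c 5) * X 1 ^ 2 : MvPolynomial (Fin 3) R).IsHomogeneous 2 := by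
  have hX : ∀ (r : R) (i j : Fin 3), (C r * (X i * X j)).IsHomogeneous 2 := fun r i j =>
    (isHomogeneous_C (Fin 3) r).mul ((isHomogeneous_X R i).mul (isHomogeneous_X R j))
  simp only [sq]
  exact (((((hX _ _ _).add (hX _ _ _)).add (hX _ _ _)).add (hX _ _ _)).add (hX _ _ _)).add
    (hX _ _ _)

theorem isHomogeneous_P {R : Type*} [CommRing R] (a : Coef → R) : (P a).IsHomogeneous 2 :=
  isHomogeneous_ternary ![a a00, a a10, a a01, a a20, 2 * a a11, a a02]

theorem isHomogeneous_Q {R : Type*} [CommRing R] (a : Coef → R) : (Q a).IsHomogeneous 2 :=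
  isHomogeneous_ternary ![a b00, a b10, a b01, a b20, 2 * a b11, a b02]

theorem aeval_skewChart_ternary (v : ℂ) (c : Fin 6 → ℂ) :
    aeval (skewChart v) (C (c 0) * X 2 ^ 2 + C (c 1) * (X 0 * X 2) + C (c 2) * (X 1 * X 2)
      + C (c 3) * X 0 ^ 2 + C (c 4) * (X 0 * X 1) + C (c 5) * X 1 ^ 2) =
    quadPoly (c 3 + c 4 * v + c 5 * v ^ 2)
      (Polynomial.C (c 4 + 2 * c 5 * v) + Polynomial.C (c 1 + c 2 * v) * Polynomial.X)
      (Polynomial.C (c 5) + Polynomial.C (c 2) * Polynomial.X +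
        Polynomial.C (c 0) * Polynomial.X ^ 2) := by
  have hX : zPoly Polynomial.X = X 1 := by simp [zPoly]
  simp only [quadPoly, skewChart, map_add, map_mul, map_pow, aeval_X, algHom_C, zPoly_C, hX,
    MvPolynomial.algebraMap_eq, Matrix.cons_val, map_ofNat]
  ring

theorem aeval_skewChart_P (a : Coef → ℂ) (v : ℂ) :
    aeval (skewChart v) (P a) = quadPoly (a a20 + 2 * a a11 * v + a a02 * v ^ 2)
      (Polynomial.C (2 * a a11 + 2 * a a02 * v) +
        Polynomial.C (a a10 + a a01 * v) * Polynomial.X)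
      (Polynomial.C (a a02) + Polynomial.C (a a01) * Polynomial.X +
        Polynomial.C (a a00) * Polynomial.X ^ 2) :=
  aeval_skewChart_ternary v ![a a00, a a10, a a01, a a20, 2 * a a11, a a02]

theorem aeval_skewChart_Q (a : Coef → ℂ) (v : ℂ) :
    aeval (skewChart v) (Q a) = quadPoly (a b20 + 2 * a b11 * v + a b02 * v ^ 2)
      (Polynomial.C (2 * a b11 + 2 * a b02 * v) +
        Polynomial.C (a b10 + a b01 * v) * Polynomial.X)
      (Polynomial.C (a b02) + Polynomial.C (a b01) * Polynomial.X +
        Polynomial.C (a b00) * Polynomial.X ^ 2) :=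
  aeval_skewChart_ternary v ![a b00, a b10, a b01, a b20, 2 * a b11, a b02]

theorem rep_chartIndex_ne_zero (w : Projectivization ℂ (Fin 3 → ℂ)) : w.rep (chartIndex w) ≠ 0 := by
  unfold chartIndex
  split_ifs with h0 h1
  · exact h0
  · exact h1
  · intro h2
    apply w.rep_nonzero
    funext k
    fin_cases k
    · exact not_not.mp h0
    · exact not_not.mp h1
    · exact h2

theorem eval_dehomogenize {F : MvPolynomial (Fin 3) ℂ} {n : ℕ} (hF : F.IsHomogeneous n)
    {i : Fin 3} {w : Fin 3 → ℂ} (hi : w i ≠ 0) :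
    eval (fun j => w (i.succAbove j) / w i) (dehomogenize i F) = (w i)⁻¹ ^ n * eval w F := by
  have h : eval (fun j => w (i.succAbove j) / w i) (dehomogenize i F) =
      aeval (fun k => (w i)⁻¹ * w k) F := by
    rw [← aeval_eq_eval, dehomogenize, ← AlgHom.comp_apply, comp_aeval]
    congr 2
    funext k
    rw [aeval_eq_eval]
    exact eval_stdChart hi k
  rw [h, aeval_smul_of_isHomogeneous hF, aeval_eq_eval]

theorem intersectionNumber_eq_zero {F G : MvPolynomial (Fin 3) ℂ} {n : ℕ}
    (hF : F.IsHomogeneous n) (hG : G.IsHomogeneous n) {w : Projectivization ℂ (Fin 3 → ℂ)}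
    (h : eval w.rep F ≠ 0 ∨ eval w.rep G ≠ 0) : intersectionNumber w F G = 0 := by
  have hi := rep_chartIndex_ne_zero w
  have key : ∀ {H : MvPolynomial (Fin 3) ℂ}, H.IsHomogeneous n → eval w.rep H ≠ 0 →
      eval (chartPoint w) (dehomogenize (chartIndex w) H) ≠ 0 := by
    intro H hH hne
    have := eval_dehomogenize hH hi
    rw [show eval (chartPoint w) (dehomogenize (chartIndex w) H) = _ from this]
    exact mul_ne_zero (pow_ne_zero _ (inv_ne_zero hi)) hne
  rw [intersectionNumber, affineIntersection_eq_localMult]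
  refine localMult_eq_zero fun hle => ?_
  rcases h with h | h
  · exact key hF h (mem_idealAt.mp (hle (Ideal.subset_span (by simp))))
  · exact key hG h (mem_idealAt.mp (hle (Ideal.subset_span (by simp))))

theorem intersectionNumber_eq {F G : MvPolynomial (Fin 3) ℂ} {n : ℕ}
    (hF : F.IsHomogeneous n) (hG : G.IsHomogeneous n) {w : Projectivization ℂ (Fin 3 → ℂ)}
    (hw : w.rep 2 = 0) {v : ℂ} (h : w.rep 1 - v * w.rep 0 ≠ 0) :
    intersectionNumber w F G = affineIntersection ![w.rep 0 / (w.rep 1 - v * w.rep 0), 0]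
      (aeval (skewChart v) F) (aeval (skewChart v) G) :=
  affineIntersection_stdChart hF hG hw h (rep_chartIndex_ne_zero w)

theorem infinitePoint_ne_zero (v t : ℂ) : ![t, 1 + v * t, 0] ≠ 0 := by
  intro h
  have h0 := congrFun h 0
  have h1 := congrFun h 1
  simp only [Matrix.cons_val, Pi.zero_apply] at h0 h1
  simp [h0] at h1

/-- The point `(t : 1 + v t : 0)`. -/
def infinitePoint (v t : ℂ) : Projectivization ℂ (Fin 3 → ℂ) :=
  Projectivization.mk ℂ ![t, 1 + v * t, 0] (infinitePoint_ne_zero v t)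

theorem exists_rep_infinitePoint (v t : ℂ) : ∃ r : ℂ, r ≠ 0 ∧ (infinitePoint v t).rep 0 = r * t ∧
    (infinitePoint v t).rep 1 = r * (1 + v * t) ∧ (infinitePoint v t).rep 2 = 0 := by
  obtain ⟨r, hr⟩ := Projectivization.exists_smul_eq_mk_rep ℂ ![t, 1 + v * t, 0]
    (infinitePoint_ne_zero v t)
  refine ⟨r, r.ne_zero, ?_, ?_, ?_⟩
  · exact (congrFun hr 0).symm
  · exact (congrFun hr 1).symm
  · exact (congrFun hr 2).symm.trans (mul_zero _)

theorem eq_infinitePoint {v : ℂ} {w : Projectivization ℂ (Fin 3 → ℂ)} (hw : w.rep 2 = 0)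
    (h : w.rep 1 - v * w.rep 0 ≠ 0) :
    w = infinitePoint v (w.rep 0 / (w.rep 1 - v * w.rep 0)) := by
  conv_lhs => rw [← w.mk_rep]
  rw [infinitePoint, Projectivization.mk_eq_mk_iff']
  refine ⟨w.rep 1 - v * w.rep 0, ?_⟩
  funext k
  fin_cases k
  · simp [mul_div_cancel₀ _ h]
  · simp
    field_simp
    ring
  · simp [hw]

/-- On `Z = 0` the skew chart omits only `(1 : v : 0)`, through which one of the curves does not
pass. The other points correspond bijectively to `t ∈ ℂ`, so the finite partial sums are bounded by
the sum over `s`, which is itself one of them. -/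
theorem iSup_intersectionNumber {F G : MvPolynomial (Fin 3) ℂ} {n : ℕ}
    (hF : F.IsHomogeneous n) (hG : G.IsHomogeneous n) {v : ℂ}
    (hv : eval ![1, v, 0] F ≠ 0 ∨ eval ![1, v, 0] G ≠ 0) {s : Finset ℂ}
    (hs : ∀ t ∉ s, affineIntersection ![t, 0] (aeval (skewChart v) F) (aeval (skewChart v) G) = 0) :
    ⨆ σ : Finset lineAtInfinity, ∑ w ∈ σ, intersectionNumber w F G =
      ∑ t ∈ s, affineIntersection ![t, 0] (aeval (skewChart v) F) (aeval (skewChart v) G) := by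
  classical
  set h : ℂ → ℕ∞ := fun t =>
    affineIntersection ![t, 0] (aeval (skewChart v) F) (aeval (skewChart v) G) with hh
  have hzero : ∀ w : lineAtInfinity, w.1.rep 1 - v * w.1.rep 0 = 0 →
      intersectionNumber w.1 F G = 0 := by
    intro w hw
    apply intersectionNumber_eq_zero hF hG
    have hw2 : w.1.rep 2 = 0 := w.2
    have e : w.1.rep = fun k => w.1.rep 0 * ![1, v, 0] k := by
      funext k
      fin_cases k
      · simp
      · simpa [mul_comm] using sub_eq_zero.mp hw
      · simp [hw2]
    have h0 : w.1.rep 0 ≠ 0 := by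
      intro h0
      apply w.1.rep_nonzero
      rw [e, h0]
      funext k
      exact zero_mul _
    have key : ∀ {H : MvPolynomial (Fin 3) ℂ}, H.IsHomogeneous n → eval ![1, v, 0] H ≠ 0 →
        eval w.1.rep H ≠ 0 := by
      intro H hH hne
      rw [e, ← aeval_eq_eval, aeval_smul_of_isHomogeneous hH, aeval_eq_eval]
      exact mul_ne_zero (pow_ne_zero _ h0) hne
    exact hv.imp (key hF) (key hG)
  apply le_antisymm
  · refine iSup_le fun σ => ?_
    have h1 : ∑ w ∈ σ, intersectionNumber w.1 F G =
        ∑ w ∈ σ.filter (fun w => w.1.rep 1 - v * w.1.rep 0 ≠ 0),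
          h (w.1.rep 0 / (w.1.rep 1 - v * w.1.rep 0)) := by
      rw [Finset.sum_filter]
      refine Finset.sum_congr rfl fun w _ => ?_
      split_ifs with hw
      · exact intersectionNumber_eq hF hG w.2 hw
      · exact hzero w (not_not.mp hw)
    rw [h1, ← Finset.sum_image (f := h)
      (g := fun w : lineAtInfinity => w.1.rep 0 / (w.1.rep 1 - v * w.1.rep 0))]
    · refine (Finset.sum_le_sum_of_subset (Finset.subset_union_left (s₂ := s))).trans ?_
      rw [Finset.sum_subset Finset.subset_union_right fun t _ ht => hs t ht]
    · intro w hw w' hw' e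
      have hw1 := (Finset.mem_filter.mp hw).2
      have hw1' := (Finset.mem_filter.mp hw').2
      apply Subtype.ext
      rw [eq_infinitePoint w.2 hw1, eq_infinitePoint w'.2 hw1']
      exact congrArg _ e
  · have hmem : ∀ t, infinitePoint v t ∈ lineAtInfinity := fun t => by
      obtain ⟨r, _, _, _, h2⟩ := exists_rep_infinitePoint v t
      exact h2
    have hcoord : ∀ t, (infinitePoint v t).rep 1 - v * (infinitePoint v t).rep 0 ≠ 0 ∧
        (infinitePoint v t).rep 0 /
          ((infinitePoint v t).rep 1 - v * (infinitePoint v t).rep 0) = t := by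
      intro t
      obtain ⟨r, hr, h0, h1, _⟩ := exists_rep_infinitePoint v t
      have e : (infinitePoint v t).rep 1 - v * (infinitePoint v t).rep 0 = r := by
        rw [h0, h1]
        ring
      rw [e, h0]
      exact ⟨hr, mul_div_cancel_left₀ t hr⟩
    refine le_trans (le_of_eq ?_) (le_iSup _ (s.image fun t => ⟨infinitePoint v t, hmem t⟩))
    rw [Finset.sum_image]
    · refine Finset.sum_congr rfl fun t _ => ?_
      rw [intersectionNumber_eq hF hG (hmem t) (hcoord t).1, (hcoord t).2]
    · intro t _ t' _ e
      have e' : infinitePoint v t = infinitePoint v t' := congrArg Subtype.val e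
      rw [← (hcoord t).2, ← (hcoord t').2, e']

/-! ### The count at infinity read in one direction `v` -/

theorem muCoeff_map {R S : Type*} [CommRing R] [CommRing S] (φ : R →+* S) (a : Coef → R) (i j : ℕ) :
    muCoeff (fun k => φ (a k)) i j = φ (muCoeff a i j) := by
  unfold muCoeff
  split <;> simp only [map_add, map_sub, map_mul, map_neg, map_pow, map_ofNat, map_zero]

theorem quadRes_skewChart (a : Coef → ℂ) (v : ℂ) :
    quadRes (Polynomial.C (a a20 + 2 * a a11 * v + a a02 * v ^ 2))
      (Polynomial.C (2 * a a11 + 2 * a a02 * v) +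
        Polynomial.C (a a10 + a a01 * v) * Polynomial.X)
      (Polynomial.C (a a02) + Polynomial.C (a a01) * Polynomial.X +
        Polynomial.C (a a00) * Polynomial.X ^ 2)
      (Polynomial.C (a b20 + 2 * a b11 * v + a b02 * v ^ 2))
      (Polynomial.C (2 * a b11 + 2 * a b02 * v) +
        Polynomial.C (a b10 + a b01 * v) * Polynomial.X)
      (Polynomial.C (a b02) + Polynomial.C (a b01) * Polynomial.X +
        Polynomial.C (a b00) * Polynomial.X ^ 2) =
    ∑ i ∈ Finset.range 5, Polynomial.C (∑ j ∈ Finset.range (i + 1), muCoeff a i j * v ^ j) *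
      Polynomial.X ^ i := by
  have h := quadRes_direction (fun k => Polynomial.C (a k)) (Polynomial.C v) Polynomial.X
  simp only [muCoeff_map] at h
  simpa only [map_sum, map_add, map_mul, map_pow, map_ofNat] using h

theorem eval_P_direction (a : Coef → ℂ) (v : ℂ) :
    eval ![1, v, 0] (P a) = a a20 + 2 * a a11 * v + a a02 * v ^ 2 := by
  simp [P]

theorem eval_Q_direction (a : Coef → ℂ) (v : ℂ) :
    eval ![1, v, 0] (Q a) = a b20 + 2 * a b11 * v + a b02 * v ^ 2 := by
  simp [Q]

/-- The number of solutions at infinity is the order of the resultant formed in a direction that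
is not a common zero of the quadratic parts. -/
theorem numSolutionsAtInfinity_eq (a : Coef → ℝ) {v : ℂ}
    (hv : eval ![1, v, 0] (P (toComplex a)) ≠ 0 ∨ eval ![1, v, 0] (Q (toComplex a)) ≠ 0)
    {m : ℕ} {u : Polynomial ℂ} (hu : u.eval 0 ≠ 0)
    (h : ∑ i ∈ Finset.range 5, Polynomial.C (∑ j ∈ Finset.range (i + 1),
      muCoeff (toComplex a) i j * v ^ j) * Polynomial.X ^ i = Polynomial.X ^ m * u) :
    numSolutionsAtInfinity a = m := by
  have hv' := hv
  rw [eval_P_direction, eval_Q_direction] at hv'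
  rw [← quadRes_skewChart] at h
  obtain ⟨s, hsum, hs⟩ := sum_affineIntersection hv' hu h
  rw [← aeval_skewChart_P, ← aeval_skewChart_Q] at hsum hs
  rw [← hsum]
  exact iSup_intersectionNumber (isHomogeneous_P _) (isHomogeneous_Q _) hv hs

/-- The isomorphism `ℂ[x, y] ≃ ℂ[X][Y]` with `x ↦ Y` and `y ↦ v Y + X`. -/
def shearHom (v : ℂ) : MvPolynomial (Fin 2) ℂ →ₐ[ℂ] Polynomial (Polynomial ℂ) :=
  aeval ![Polynomial.X, Polynomial.C (Polynomial.C v) * Polynomial.X + Polynomial.C Polynomial.X]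

/-- The inverse of `shearHom`. -/
def shearInv (v : ℂ) : Polynomial (Polynomial ℂ) →ₐ[ℂ] MvPolynomial (Fin 2) ℂ :=
  Polynomial.eval₂AlgHom (Polynomial.aeval (X 1 - C v * X 0)) (X 0) fun _ => Commute.all _ _

theorem shearInv_shearHom (v : ℂ) (f : MvPolynomial (Fin 2) ℂ) : shearInv v (shearHom v f) = f := by
  have h : (shearInv v).comp (shearHom v) = AlgHom.id ℂ _ := by
    apply MvPolynomial.algHom_ext
    intro i
    fin_cases i <;> simp [shearInv, shearHom, MvPolynomial.algebraMap_eq]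
  exact congrArg (fun φ : MvPolynomial (Fin 2) ℂ →ₐ[ℂ] MvPolynomial (Fin 2) ℂ => φ f) h

theorem shearHom_shearInv (v : ℂ) (f : Polynomial (Polynomial ℂ)) :
    shearHom v (shearInv v f) = f := by
  have h0 : ∀ g : Polynomial ℂ, shearHom v (Polynomial.aeval (X 1 - C v * X 0) g) =
      Polynomial.C g := by
    intro g
    have h : (shearHom v).comp (Polynomial.aeval (X 1 - C v * X 0)) =
        Polynomial.CAlgHom (R := ℂ) := by
      apply Polynomial.algHom_ext
      simp [shearHom, Polynomial.algebraMap_apply]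
    exact congrArg (fun φ : Polynomial ℂ →ₐ[ℂ] Polynomial (Polynomial ℂ) => φ g) h
  induction f using Polynomial.induction_on' with
  | add f g hf hg => rw [map_add, map_add, hf, hg]
  | monomial n g =>
    have h1 : shearInv v (Polynomial.monomial n g) =
        Polynomial.aeval (X 1 - C v * X 0) g * X 0 ^ n := by
      simp [shearInv]
    rw [h1, map_mul, h0, map_pow, ← Polynomial.C_mul_X_pow_eq_monomial]
    simp [shearHom]

theorem isRelPrime_shearHom (v : ℂ) {f g : MvPolynomial (Fin 2) ℂ} (h : IsRelPrime f g) :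
    IsRelPrime (shearHom v f) (shearHom v g) := by
  intro d hf hg
  have h1 := h (by simpa only [shearInv_shearHom] using map_dvd (shearInv v) hf)
    (by simpa only [shearInv_shearHom] using map_dvd (shearInv v) hg)
  simpa only [shearHom_shearInv] using h1.map (shearHom v)

theorem shearHom_binary (v : ℂ) (c : Fin 6 → ℂ) :
    shearHom v (C (c 0) + C (c 1) * X 0 + C (c 2) * X 1 + C (c 3) * X 0 ^ 2
      + C (c 4) * (X 0 * X 1) + C (c 5) * X 1 ^ 2) =
    Polynomial.C (Polynomial.C (c 3 + c 4 * v + c 5 * v ^ 2)) * Polynomial.X ^ 2 +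
      Polynomial.C (Polynomial.C (c 1 + c 2 * v) +
        Polynomial.C (c 4 + 2 * c 5 * v) * Polynomial.X) * Polynomial.X +
      Polynomial.C (Polynomial.C (c 0) + Polynomial.C (c 2) * Polynomial.X +
        Polynomial.C (c 5) * Polynomial.X ^ 2) := by
  simp only [shearHom, map_add, map_mul, map_pow, aeval_X, algHom_C,
    Polynomial.algebraMap_apply, Matrix.cons_val, map_ofNat, Algebra.algebraMap_self_apply]
  ring

/-- The same quartic form in `Y - v X` and `Z` as in `quadRes_skewChart`, now dehomogenized at `Z =
1`; hence the complementary exponents. It connects the resultant at infinity with the affine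
polynomials `p` and `q`. -/
theorem quadRes_shear (a : Coef → ℂ) (v : ℂ) :
    quadRes (Polynomial.C (a a20 + 2 * a a11 * v + a a02 * v ^ 2))
      (Polynomial.C (a a10 + a a01 * v) +
        Polynomial.C (2 * a a11 + 2 * a a02 * v) * Polynomial.X)
      (Polynomial.C (a a00) + Polynomial.C (a a01) * Polynomial.X +
        Polynomial.C (a a02) * Polynomial.X ^ 2)
      (Polynomial.C (a b20 + 2 * a b11 * v + a b02 * v ^ 2))
      (Polynomial.C (a b10 + a b01 * v) +
        Polynomial.C (2 * a b11 + 2 * a b02 * v) * Polynomial.X)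
      (Polynomial.C (a b00) + Polynomial.C (a b01) * Polynomial.X +
        Polynomial.C (a b02) * Polynomial.X ^ 2) =
    ∑ i ∈ Finset.range 5, Polynomial.C (∑ j ∈ Finset.range (i + 1), muCoeff a i j * v ^ j) *
      Polynomial.X ^ (4 - i) := by
  simp only [quadRes, Finset.sum_range_succ, Finset.sum_range_zero, muCoeff, map_add, map_sub,
    map_mul, map_neg, map_pow, map_ofNat, map_zero]
  ring

/-- Otherwise the resultant of the sheared `p` and `q` would be zero although they are coprime; the
condition on `v` makes one leading coefficient a unit. -/
theorem exists_sum_muCoeff_ne_zero (a : Coef → ℂ) {v : ℂ}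
    (hv : eval ![1, v, 0] (P a) ≠ 0 ∨ eval ![1, v, 0] (Q a) ≠ 0)
    (h : IsRelPrime (p a) (q a)) :
    ∃ i < 5, ∑ j ∈ Finset.range (i + 1), muCoeff a i j * v ^ j ≠ 0 := by
  by_contra! hc
  have h1 := isRelPrime_shearHom v h
  have ep : shearHom v (p a) = _ :=
    shearHom_binary v ![a a00, a a10, a a01, a a20, 2 * a a11, a a02]
  have eq : shearHom v (q a) = _ :=
    shearHom_binary v ![a b00, a b10, a b01, a b20, 2 * a b11, a b02]
  rw [ep, eq] at h1
  rw [eval_P_direction, eval_Q_direction] at hv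
  refine quadRes_ne_zero (hv.imp (fun e => Polynomial.isUnit_C.mpr (IsUnit.mk0 _ e))
    fun e => Polynomial.isUnit_C.mpr (IsUnit.mk0 _ e)) h1 ((quadRes_shear a v).trans ?_)
  refine Finset.sum_eq_zero fun i hi => ?_
  rw [hc i (Finset.mem_range.mp hi), map_zero, zero_mul]

/-- `N` is the least `i` with `μ_i(1, v) ≠ 0`, that is, the order at `z = 0` of the resultant in
direction `v`. -/
theorem exists_numSolutionsAtInfinity (a : Coef → ℝ)
    (h : IsRelPrime (p (toComplex a)) (q (toComplex a))) {v : ℝ}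
    (hv : a a20 + 2 * a a11 * v + a a02 * v ^ 2 ≠ 0 ∨
      a b20 + 2 * a b11 * v + a b02 * v ^ 2 ≠ 0) :
    ∃ N : ℕ, N ≤ 4 ∧ numSolutionsAtInfinity a = (N : ℕ∞) ∧
      (∀ i < N, ∑ j ∈ Finset.range (i + 1), muCoeff a i j * v ^ j = 0) ∧
      ∑ j ∈ Finset.range (N + 1), muCoeff a N j * v ^ j ≠ 0 := by
  classical
  have hv' : eval ![1, (v : ℂ), 0] (P (toComplex a)) ≠ 0 ∨
      eval ![1, (v : ℂ), 0] (Q (toComplex a)) ≠ 0 := by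
    rw [eval_P_direction, eval_Q_direction]
    simp only [toComplex]
    exact_mod_cast hv
  have hcast : ∀ i, ∑ j ∈ Finset.range (i + 1), muCoeff (toComplex a) i j * (v : ℂ) ^ j =
      ((∑ j ∈ Finset.range (i + 1), muCoeff a i j * v ^ j : ℝ) : ℂ) := by
    intro i
    push_cast
    refine Finset.sum_congr rfl fun j _ => ?_
    congr 1
    exact muCoeff_map Complex.ofRealHom a i j
  have hex := exists_sum_muCoeff_ne_zero (toComplex a) hv' h
  set N := Nat.find hex with hN
  obtain ⟨hN5, hNne⟩ := Nat.find_spec hex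
  have hlt : ∀ i < N, ∑ j ∈ Finset.range (i + 1), muCoeff (toComplex a) i j * (v : ℂ) ^ j = 0 := by
    intro i hi
    by_contra hne
    exact Nat.find_min hex hi ⟨hi.trans hN5, hne⟩
  refine ⟨N, by omega, ?_, ?_, ?_⟩
  · set R := ∑ i ∈ Finset.range 5, Polynomial.C (∑ j ∈ Finset.range (i + 1),
      muCoeff (toComplex a) i j * (v : ℂ) ^ j) * Polynomial.X ^ i with hR
    have hcoeff : ∀ d < 5, R.coeff d =
        ∑ j ∈ Finset.range (d + 1), muCoeff (toComplex a) d j * (v : ℂ) ^ j := by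
      intro d hd
      rw [hR, Polynomial.finsetSum_coeff]
      simp only [Polynomial.coeff_C_mul_X_pow]
      rw [Finset.sum_ite_eq, if_pos (Finset.mem_range.mpr hd)]
    obtain ⟨u, hu⟩ : Polynomial.X ^ N ∣ R := by
      rw [Polynomial.X_pow_dvd_iff]
      intro d hd
      rw [hcoeff d (hd.trans hN5), hlt d hd]
    refine numSolutionsAtInfinity_eq a hv' (u := u) ?_ hu
    rw [← Polynomial.coeff_zero_eq_eval_zero]
    intro h0
    apply hNne
    rw [← hcoeff N hN5, hu]
    simpa using Polynomial.coeff_X_pow_mul u N 0 |>.trans h0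
  · intro i hi
    have := hlt i hi
    rw [hcast] at this
    exact_mod_cast this
  · intro h0
    apply hNne
    rw [hcast, h0, Complex.ofReal_zero]

/-! ### Independence of the direction -/

theorem exists_quadratic_coeff_ne_zero (a : Coef → ℝ)
    (h : max (p a).totalDegree (q a).totalDegree = 2) :
    (a a20 ≠ 0 ∨ a a11 ≠ 0 ∨ a a02 ≠ 0) ∨ (a b20 ≠ 0 ∨ a b11 ≠ 0 ∨ a b02 ≠ 0) := by
  by_contra! hc
  obtain ⟨⟨h1, h2, h3⟩, h4, h5, h6⟩ := hc
  have key : ∀ r s t : ℝ, (C r + C s * X 0 + C t * X 1 : MvPolynomial (Fin 2) ℝ).totalDegree ≤ 1 := by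
    intro r s t
    have hl : ∀ (s : ℝ) (i : Fin 2), (C s * X i : MvPolynomial (Fin 2) ℝ).totalDegree ≤ 1 :=
      fun s i => (totalDegree_mul _ _).trans (by simp)
    exact (totalDegree_add _ _).trans (max_le ((totalDegree_add _ _).trans
      (max_le (by simp) (hl s 0))) (hl t 1))
  have ep : p a = C (a a00) + C (a a10) * X 0 + C (a a01) * X 1 := by simp [p, h1, h2, h3]
  have eq : q a = C (a b00) + C (a b10) * X 0 + C (a b01) * X 1 := by simp [q, h4, h5, h6]
  rw [ep, eq] at h
  have := max_le (key (a a00) (a a10) (a a01)) (key (a b00) (a b10) (a b01))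
  omega

theorem finite_quadratic_roots {c₂ c₁ c₀ : ℝ} (h : c₀ ≠ 0 ∨ c₁ ≠ 0 ∨ c₂ ≠ 0) :
    {v : ℝ | c₀ + 2 * c₁ * v + c₂ * v ^ 2 = 0}.Finite := by
  set f : Polynomial ℝ := Polynomial.C c₂ * Polynomial.X ^ 2 + Polynomial.C (2 * c₁) * Polynomial.X +
    Polynomial.C c₀ with hf
  have hf0 : f ≠ 0 := by
    intro e
    have e0 := congrArg (fun g => Polynomial.coeff g 0) e
    have e1 := congrArg (fun g => Polynomial.coeff g 1) e
    have e2 := congrArg (fun g => Polynomial.coeff g 2) e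
    simp [hf, Polynomial.coeff_X, Polynomial.coeff_C] at e0 e1 e2
    tauto
  refine (Polynomial.finite_setOfPred_isRoot hf0).subset fun v hv => ?_
  have hv' : c₀ + 2 * c₁ * v + c₂ * v ^ 2 = 0 := hv
  simp only [Set.mem_ofPred_eq, Polynomial.IsRoot.def, hf, Polynomial.eval_add, Polynomial.eval_mul,
    Polynomial.eval_C, Polynomial.eval_pow, Polynomial.eval_X]
  linarith

theorem infinite_good_directions (a : Coef → ℝ)
    (h : max (p a).totalDegree (q a).totalDegree = 2) :
    {v : ℝ | a a20 + 2 * a a11 * v + a a02 * v ^ 2 ≠ 0 ∨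
      a b20 + 2 * a b11 * v + a b02 * v ^ 2 ≠ 0}.Infinite := by
  rcases exists_quadratic_coeff_ne_zero a h with h | h
  · exact (finite_quadratic_roots h).infinite_compl.mono fun v hv => Or.inl hv
  · exact (finite_quadratic_roots h).infinite_compl.mono fun v hv => Or.inr hv

theorem muAt_eq_zero_iff (a : Coef → ℝ) {i : ℕ} (hi : i ≤ 4) :
    muAt a i = 0 ↔ ∀ j ≤ i, muCoeff a i j = 0 := by
  constructor
  · intro h j hj
    rw [← coeff_muAt a hi hj, h, coeff_zero]
  · intro h
    rw [muAt_eq a hi]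
    refine Finset.sum_eq_zero fun j hj => ?_
    rw [h j (by have := Finset.mem_range.mp hj; omega), map_zero, zero_mul]

theorem muAt_eq_zero_of_infinite (a : Coef → ℝ) {i : ℕ} (hi : i ≤ 4) {S : Set ℝ} (hS : S.Infinite)
    (h : ∀ v ∈ S, ∑ j ∈ Finset.range (i + 1), muCoeff a i j * v ^ j = 0) : muAt a i = 0 := by
  rw [muAt_eq_zero_iff a hi]
  intro j hj
  set f : Polynomial ℝ :=
    ∑ j ∈ Finset.range (i + 1), Polynomial.C (muCoeff a i j) * Polynomial.X ^ j with hf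
  have hf0 : f = 0 := by
    refine Polynomial.eq_zero_of_infinite_isRoot f (hS.mono fun v hv => ?_)
    rw [Set.mem_ofPred_eq, Polynomial.IsRoot.def, hf, Polynomial.eval_finsetSum, ← h v hv]
    simp
  have h1 : f.coeff j = muCoeff a i j := by
    rw [hf, Polynomial.finsetSum_coeff]
    simp only [Polynomial.coeff_C_mul_X_pow]
    rw [Finset.sum_ite_eq, if_pos (Finset.mem_range.mpr (by omega))]
  rw [← h1, hf0, Polynomial.coeff_zero]

theorem exists_numSolutionsAtInfinity_muAt (a : Coef → ℝ)
    (hdeg : max (p a).totalDegree (q a).totalDegree = 2)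
    (h : IsRelPrime (p (toComplex a)) (q (toComplex a))) :
    ∃ N : ℕ, N ≤ 4 ∧ numSolutionsAtInfinity a = (N : ℕ∞) ∧ (∀ i < N, muAt a i = 0) ∧ muAt a N ≠ 0 := by
  have hS := infinite_good_directions a hdeg
  obtain ⟨v, hv⟩ := hS.nonempty
  obtain ⟨N, hN, hnum, _, hne⟩ := exists_numSolutionsAtInfinity a h hv
  refine ⟨N, hN, hnum, fun i hi => ?_, fun h0 => hne ?_⟩
  · refine muAt_eq_zero_of_infinite a (by omega) hS fun w hw => ?_
    -- The order in direction `w` is the same number of solutions at infinity, so `M = N`.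
    obtain ⟨M, _, hnumM, hlt, _⟩ := exists_numSolutionsAtInfinity a h hw
    have hNM : N = M := by exact_mod_cast hnum.symm.trans hnumM
    exact hlt i (hNM ▸ hi)
  · rw [muAt_eq_zero_iff a hN] at h0
    refine Finset.sum_eq_zero fun j hj => ?_
    rw [h0 j (by have := Finset.mem_range.mp hj; omega), zero_mul]

end QuadSys

end

theorem mainTheorem3 :
    (∀ a : QuadSys.Coef → ℝ,
      (∀ i ≤ 4, (QuadSys.muAt a i).IsHomogeneous i) ∧
      QuadSys.resQuadratic 0 (QuadSys.P a) (QuadSys.Q a) =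
        ∑ i ∈ Finset.range 5,
          MvPolynomial.C (MvPolynomial.coeff (Finsupp.single 0 i) (QuadSys.muAt a i)) *
            (MvPolynomial.X 1 ^ (4 - i) * MvPolynomial.X 2 ^ i) ∧
      QuadSys.resQuadratic 1 (QuadSys.P a) (QuadSys.Q a) =
        ∑ i ∈ Finset.range 5,
          MvPolynomial.C ((-1) ^ i *
              MvPolynomial.coeff (Finsupp.single 1 i) (QuadSys.muAt a i)) *
            (MvPolynomial.X 0 ^ (4 - i) * MvPolynomial.X 2 ^ i)) ∧
    (∀ a : QuadSys.Coef → ℝ,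
      max (QuadSys.p a).totalDegree (QuadSys.q a).totalDegree = 2 →
      IsRelPrime (QuadSys.p (QuadSys.toComplex a)) (QuadSys.q (QuadSys.toComplex a)) →
      ∀ m : ℕ, 1 ≤ m → m ≤ 4 →
        (QuadSys.numSolutionsAtInfinity a = (m : ℕ∞) ↔
          (∀ i < m, QuadSys.muAt a i = 0) ∧ QuadSys.muAt a m ≠ 0)) := by
  refine ⟨fun a => ⟨fun i hi => QuadSys.isHomogeneous_muAt a hi, QuadSys.resQuadratic_X a,
    QuadSys.resQuadratic_Y a⟩, ?_⟩
  intro a hdeg hrel m _ hm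
  obtain ⟨N, hN, hnum, hzero, hne⟩ := QuadSys.exists_numSolutionsAtInfinity_muAt a hdeg hrel
  rw [hnum]
  constructor
  · intro h
    have hNm : N = m := by exact_mod_cast h
    exact hNm ▸ ⟨hzero, hne⟩
  · rintro ⟨hz, hn⟩
    rcases lt_trichotomy N m with hlt | heq | hgt
    · exact absurd (hz N hlt) hne
    · rw [heq]
    · exact absurd (hzero m hgt) hn
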